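/- Call a plane graph a finite simple graph drawn in the Euclidean plane $\mathbb{R}^2$ without crossings: vertices are distinct points, each edge is a (polygonal) arc joining its two ends and containing no other vertex, and two distinct edges meet at most in common ends. It need not be connected. Its faces are the connected components of the complement of the drawing (including the unbounded one), and the length of a face is the number of edges on its boundary, an edge with the face on both of its sides being counted twice. **Corollary 3.** Let $n \ge 4$ be an integer. The maximum number $E_4(n)$ of edges of a plane graph on $n$ vertices in which every vertex lies on the boundary of a face of length at least $4$ is $$E_4(n) = \left\lfloor \frac{11}{4}\,n - 6 \right\rfloor .$$ In particular, this maximum is attained. -/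

import Mathlib

/-- The union of the straight line segments joining consecutive points of a list of points of the
Euclidean plane `ℝ × ℝ`. -/
def polyline : List (ℝ × ℝ) → Set (ℝ × ℝ)
  | [] => ∅
  | [a] => {a}
  | a :: b :: l => segment ℝ a b ∪ polyline (b :: l)

/-- The polygonal line through the points of the list does not meet itself: each of its segments
is nondegenerate and meets the rest of the line after it only in its own final endpoint. -/
def IsSimplePolyline : List (ℝ × ℝ) → Prop
  | [] => False
  | [_] => True
  | a :: b :: l =>
      a ≠ b ∧ segment ℝ a b ∩ polyline (b :: l) = {b} ∧ IsSimplePolyline (b :: l)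

/-- `A` is a polygonal arc in the plane with endpoints `p` and `q`. -/
def IsPolygonalArc (p q : ℝ × ℝ) (A : Set (ℝ × ℝ)) : Prop :=
  ∃ l : List (ℝ × ℝ), IsSimplePolyline l ∧ l.head? = some p ∧ l.getLast? = some q ∧
    polyline l = A

/-- A drawing without crossings of the simple graph `G` in the plane. A simple graph together with
such a drawing is a plane graph. (Only the values of `arc` at the edges of `G` matter.) -/
structure PlaneDrawing {V : Type*} (G : SimpleGraph V) where
  /-- the point of the plane that represents a vertex -/
  point : V → ℝ × ℝ
  /-- the arc that represents an edge -/
  arc : Sym2 V → Set (ℝ × ℝ)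
  point_injective : Function.Injective point
  /-- each edge is drawn as a polygonal arc between its two ends -/
  arc_isPolygonalArc : ∀ e ∈ G.edgeSet, ∃ u v : V, e = s(u, v) ∧
    IsPolygonalArc (point u) (point v) (arc e)
  /-- an edge passes through no vertex other than its ends -/
  mem_of_point_mem_arc : ∀ e ∈ G.edgeSet, ∀ v : V, point v ∈ arc e → v ∈ e
  /-- two edges meet only in common ends -/
  arc_inter_arc : ∀ e ∈ G.edgeSet, ∀ e' ∈ G.edgeSet, e ≠ e' → ∀ x ∈ arc e ∩ arc e',
    ∃ v : V, v ∈ e ∧ v ∈ e' ∧ point v = x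

namespace PlaneDrawing

/-- The set of points of the plane covered by the vertices and edges. -/
def support {V : Type*} {G : SimpleGraph V} (D : PlaneDrawing G) : Set (ℝ × ℝ) :=
  Set.range D.point ∪ ⋃ e ∈ G.edgeSet, D.arc e

/-- The faces are the connected components of the complement of the drawing; the unbounded one
is included. -/
def IsFace {V : Type*} {G : SimpleGraph V} (D : PlaneDrawing G) (F : Set (ℝ × ℝ)) : Prop :=
  ∃ x ∈ D.supportᶜ, F = connectedComponentIn D.supportᶜ x

/-- The edges on the boundary of a face. -/
def boundaryEdges {V : Type*} {G : SimpleGraph V} (D : PlaneDrawing G) (F : Set (ℝ × ℝ)) :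
    Set (Sym2 V) :=
  {e | e ∈ G.edgeSet ∧ D.arc e ⊆ frontier F}

/-- The length of a face, which is the total length of the closed walks bounding it: the number of
edges on its boundary, where an edge that has this face on both of its sides (that is, an edge on
the boundary of no other face) is counted twice. -/
noncomputable def faceLength {V : Type*} {G : SimpleGraph V} (D : PlaneDrawing G)
    (F : Set (ℝ × ℝ)) : ℕ :=
  (D.boundaryEdges F).ncard +
    {e ∈ D.boundaryEdges F | ∀ F', D.IsFace F' → e ∈ D.boundaryEdges F' → F' = F}.ncard

/-- Every vertex lies on the boundary of a face of length at least `k`. -/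
def EveryVertexBounds {V : Type*} {G : SimpleGraph V} (D : PlaneDrawing G) (k : ℕ) : Prop :=
  ∀ v : V, ∃ F : Set (ℝ × ℝ), D.IsFace F ∧ D.point v ∈ frontier F ∧ k ≤ D.faceLength F

end PlaneDrawing

/-- The numbers of edges of the plane graphs on `n` vertices in which each vertex bounds some
`ℓ`-gon with `ℓ ≥ k`. -/
def planeEdgeCounts (k n : ℕ) : Set ℤ :=
  {m | ∃ (G : SimpleGraph (Fin n)) (D : PlaneDrawing G),
    D.EveryVertexBounds k ∧ (G.edgeSet.ncard : ℤ) = m}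

/-!
The upper bound is a count of the sides of edges. Suppose that `m` edges bound `f` faces, that `p`
of the `n` vertices are not isolated, and that every vertex lies on a face of length at least `4`.
Each edge has two sides, so the face lengths sum to at most `2m` (`sum_faceLength_le`). Each face
has length at least `3` (`face_unique_of_faceLength_le_two`: a shorter face would be the only
one). A face of length `L` has at most `L` vertices that are not isolated
(`ncard_boundaryVertices_le`), and `L - 3 ≥ L / 4` for `L ≥ 4`, so that `2m ≥ 3f + p / 4`. With
Euler's inequality `f ≥ m - p + 2` (`ncard_edgeSet_add_two_le`) this gives `m ≤ 11p / 4 - 6`.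

The topology behind these counts is local. Close to any of its points a drawing consists of
finitely many radii (`ConicAt`): two inside an edge, and one for each edge at a vertex. The
sectors between neighbouring radii are connected, so each of them lies in one face, which has both
radii in its closure. Hence an edge bounds at most two faces, and a face at a vertex has a corner
there.

Euler's inequality comes from complex analysis in place of the Jordan curve theorem. The sum of
`log ((b - z) / (a - z))` over the segments `[a, b]` of an edge has a derivative that depends only
on the ends of the edge. For a flow on the edges with boundary `0`, the combination of these
functions has derivative `0` and is constant on each face, whereas it jumps across an edge by
`2πi` times the value of the flow (`coeff_eq_zero_of_const`). So the flows with boundary `0`, a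
space of dimension at least `m - p + 1`, inject into the functions on the faces modulo constants.

The bound is attained by straight-line drawings on a fixed base `1, 2` (`blockDrawing`). Inside an
empty triangle with apex `c` on this base a block of four vertices is added: `v₁`, joined to the
base; `v₂` between `v₁` and `c`, joined to the base and to `c`; `v₃` and `v₄`, in the two
triangles `v₁ v₂ 1` and `v₁ v₂ 2`, joined to their corners. This gives `2`, `3`, `3`, `3` new
edges. After each addition all new vertices lie on one quadrilateral, in the end `v₁ v₃ v₂ v₄`,
and the triangle with apex `v₁` remains empty for the next block.
-/

open Set Filter Topology

/-! ### Directions at a point of a polygonal line -/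

/-- The unit vector of the plane that points in the direction of the angle `θ`. -/
noncomputable def unitVec (θ : Real.Angle) : ℝ × ℝ := (θ.cos, θ.sin)

theorem exists_eq_smul_unitVec {v : ℝ × ℝ} (hv : v ≠ 0) :
    ∃ (s : ℝ) (θ : Real.Angle), 0 < s ∧ v = s • unitVec θ := by
  set z : ℂ := ⟨v.1, v.2⟩ with hz
  have hz0 : z ≠ 0 := by
    intro h
    apply hv
    ext
    · simpa [hz] using congrArg Complex.re h
    · simpa [hz] using congrArg Complex.im h
  refine ⟨‖z‖, (Complex.arg z : ℝ), norm_pos_iff.mpr hz0, ?_⟩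
  ext
  · simp [unitVec, Complex.norm_mul_cos_arg, hz]
  · simp [unitVec, Complex.norm_mul_sin_arg, hz]

theorem smul_unitVec_inj {s t : ℝ} (hs : 0 < s) (ht : 0 < t) {θ φ : Real.Angle}
    (h : s • unitVec θ = t • unitVec φ) : s = t ∧ θ = φ := by
  have h1 : s * θ.cos = t * φ.cos := by simpa [unitVec] using congrArg Prod.fst h
  have h2 : s * θ.sin = t * φ.sin := by simpa [unitVec] using congrArg Prod.snd h
  have hst : s = t := by
    have e1 := θ.cos_sq_add_sin_sq
    have e2 := φ.cos_sq_add_sin_sq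
    have : s ^ 2 = t ^ 2 := by
      calc s ^ 2 = (s * θ.cos) ^ 2 + (s * θ.sin) ^ 2 := by
            rw [mul_pow, mul_pow, ← mul_add, e1, mul_one]
        _ = t ^ 2 := by rw [h1, h2, mul_pow, mul_pow, ← mul_add, e2, mul_one]
    exact (pow_left_inj₀ hs.le ht.le two_ne_zero).mp this
  subst hst
  refine ⟨rfl, ?_⟩
  replace h1 := mul_left_cancel₀ hs.ne' h1
  replace h2 := mul_left_cancel₀ hs.ne' h2
  induction θ using Real.Angle.induction_on with | h θ =>
  induction φ using Real.Angle.induction_on with | h φ =>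
  exact Real.Angle.cos_sin_inj h1 h2

theorem unitVec_ne_zero (θ : Real.Angle) : unitVec θ ≠ 0 := by
  intro h
  have e1 := θ.cos_sq_add_sin_sq
  have h1 : θ.cos = 0 := congrArg Prod.fst h
  have h2 : θ.sin = 0 := congrArg Prod.snd h
  simp [h1, h2] at e1

/-- Near the point `x`, and apart from `x` itself, the set `A` is the union of the radii from `x`
in the directions of `D`. -/
def ConicAt (A : Set (ℝ × ℝ)) (x : ℝ × ℝ) (D : Set Real.Angle) : Prop :=
  ∃ r > 0, ∀ t : ℝ, 0 < t → t < r → ∀ θ, x + t • unitVec θ ∈ A ↔ θ ∈ D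

theorem ConicAt.union {A B : Set (ℝ × ℝ)} {x : ℝ × ℝ} {D E : Set Real.Angle}
    (hA : ConicAt A x D) (hB : ConicAt B x E) : ConicAt (A ∪ B) x (D ∪ E) := by
  obtain ⟨r, hr, h⟩ := hA
  obtain ⟨r', hr', h'⟩ := hB
  refine ⟨min r r', lt_min hr hr', fun t ht0 ht θ => ?_⟩
  rw [mem_union, mem_union, h t ht0 (ht.trans_le (min_le_left _ _)),
    h' t ht0 (ht.trans_le (min_le_right _ _))]

theorem ConicAt.biUnion {ι : Type*} {s : Set ι} (hs : s.Finite) {A : ι → Set (ℝ × ℝ)}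
    {x : ℝ × ℝ} {D : ι → Set Real.Angle} (h : ∀ i ∈ s, ConicAt (A i) x (D i)) :
    ConicAt (⋃ i ∈ s, A i) x (⋃ i ∈ s, D i) := by
  induction s, hs using Set.Finite.induction_on with
  | empty => exact ⟨1, one_pos, by simp⟩
  | @insert i s hi hs ih =>
    rw [biUnion_insert, biUnion_insert]
    exact (h i (mem_insert _ _)).union (ih fun j hj => h j (mem_insert_of_mem _ hj))

theorem norm_unitVec_le (θ : Real.Angle) : ‖unitVec θ‖ ≤ 1 := by
  rw [Prod.norm_def]
  simp only [unitVec, Real.norm_eq_abs, sup_le_iff]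
  have := θ.cos_sq_add_sin_sq
  exact ⟨abs_le_one_iff_mul_self_le_one.2 (by nlinarith [sq_nonneg θ.sin]),
    abs_le_one_iff_mul_self_le_one.2 (by nlinarith [sq_nonneg θ.cos])⟩

/-- A neighbourhood of `x` contains all points at small Euclidean distance from `x`. -/
theorem exists_forall_add_smul_unitVec_mem {x : ℝ × ℝ} {U : Set (ℝ × ℝ)} (hU : U ∈ 𝓝 x) :
    ∃ r > 0, ∀ t : ℝ, 0 ≤ t → t < r → ∀ θ, x + t • unitVec θ ∈ U := by
  obtain ⟨r, hr, h⟩ := Metric.mem_nhds_iff.mp hU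
  refine ⟨r, hr, fun t ht0 ht θ => h ?_⟩
  rw [Metric.mem_ball, dist_eq_norm, add_sub_cancel_left, norm_smul, Real.norm_of_nonneg ht0]
  exact (mul_le_of_le_one_right ht0 (norm_unitVec_le θ)).trans_lt ht

theorem conicAt_empty_of_notMem {A : Set (ℝ × ℝ)} (hA : IsClosed A) {x : ℝ × ℝ} (hx : x ∉ A) :
    ConicAt A x ∅ := by
  obtain ⟨r, hr, h⟩ := exists_forall_add_smul_unitVec_mem (hA.isOpen_compl.mem_nhds hx)
  exact ⟨r, hr, fun t ht0 ht θ => by simpa using h t ht0.le ht θ⟩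

theorem conicAt_singleton (x : ℝ × ℝ) : ConicAt {x} x ∅ :=
  ⟨1, one_pos, fun t ht _ θ => by simp [ht.ne', unitVec_ne_zero]⟩

/-- Sets that meet near `x` in no other point than `x` leave `x` in different directions. -/
theorem ConicAt.disjoint {A B : Set (ℝ × ℝ)} {x : ℝ × ℝ} {D E : Set Real.Angle}
    (hA : ConicAt A x D) (hB : ConicAt B x E) (h : A ∩ B ⊆ {x}) : Disjoint D E := by
  obtain ⟨r, hr, hA⟩ := hA
  obtain ⟨r', hr', hB⟩ := hB
  rw [Set.disjoint_left]
  intro θ h1 h2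
  have h0 : 0 < min r r' / 2 := half_pos (lt_min hr hr')
  have hlt : min r r' / 2 < min r r' := half_lt_self (lt_min hr hr')
  have := h ⟨(hA _ h0 (hlt.trans_le (min_le_left _ _)) θ).2 h1,
    (hB _ h0 (hlt.trans_le (min_le_right _ _)) θ).2 h2⟩
  simp [unitVec_ne_zero, h0.ne'] at this

theorem conicAt_segment_left {a : ℝ × ℝ} {s : ℝ} (hs : 0 < s) (φ : Real.Angle) :
    ConicAt (segment ℝ a (a + s • unitVec φ)) a {φ} := by
  refine ⟨s, hs, fun t ht0 ht θ => ?_⟩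
  rw [segment_eq_image', mem_singleton_iff]
  constructor
  · rintro ⟨c, ⟨hc0, -⟩, hc⟩
    have hc : (c * s) • unitVec φ = t • unitVec θ := by
      simpa [smul_smul] using hc
    have hcs : 0 < c * s := by
      refine lt_of_le_of_ne (by positivity) fun h => ?_
      rw [← h, zero_smul] at hc
      exact smul_ne_zero ht0.ne' (unitVec_ne_zero θ) hc.symm
    exact (smul_unitVec_inj hcs ht0 hc).2.symm
  · rintro rfl
    refine ⟨t / s, ⟨by positivity, (div_le_one hs).2 ht.le⟩, ?_⟩
    simp [smul_smul, hs.ne']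

theorem conicAt_segment_endpoint {a b : ℝ × ℝ} (hab : a ≠ b) :
    ∃ θ, ConicAt (segment ℝ a b) a {θ} := by
  obtain ⟨s, θ, hs, h⟩ := exists_eq_smul_unitVec (sub_ne_zero.mpr hab.symm)
  refine ⟨θ, ?_⟩
  rw [show b = a + s • unitVec θ by rw [← h]; abel]
  exact conicAt_segment_left hs θ

theorem segment_eq_union_of_mem {a b x : ℝ × ℝ} (hx : x ∈ segment ℝ a b) :
    segment ℝ a b = segment ℝ x a ∪ segment ℝ x b := by
  apply Subset.antisymm
  · rw [segment_eq_image'] at hx ⊢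
    obtain ⟨c, ⟨hc0, hc1⟩, rfl⟩ := hx
    rintro _ ⟨d, ⟨hd0, hd1⟩, rfl⟩
    rcases le_or_gt d c with h | h
    · left
      rcases hc0.eq_or_lt with rfl | hc
      · rw [le_antisymm h hd0]; exact left_mem_segment ℝ _ _
      · rw [segment_eq_image']
        refine ⟨(c - d) / c, ⟨div_nonneg (by linarith) hc0, (div_le_one hc).2 (by linarith)⟩, ?_⟩
        ext <;> simp <;> field_simp <;> ring
    · right
      rw [segment_eq_image']
      have h1 : 0 < 1 - c := by linarith
      refine ⟨(d - c) / (1 - c), ⟨div_nonneg (by linarith) h1.le,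
        (div_le_one h1).2 (by linarith)⟩, ?_⟩
      ext <;> simp <;> field_simp <;> ring
  · exact union_subset ((convex_segment a b).segment_subset hx (left_mem_segment ℝ _ _))
      ((convex_segment a b).segment_subset hx (right_mem_segment ℝ _ _))

theorem conicAt_segment_interior {a b x : ℝ × ℝ} (hx : x ∈ segment ℝ a b) (ha : x ≠ a)
    (hb : x ≠ b) : ∃ θ φ, θ ≠ φ ∧ ConicAt (segment ℝ a b) x {θ, φ} := by
  obtain ⟨θ, hθ⟩ := conicAt_segment_endpoint ha
  obtain ⟨φ, hφ⟩ := conicAt_segment_endpoint hb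
  refine ⟨θ, φ, ?_, ?_⟩
  · have hd : Disjoint ({θ} : Set Real.Angle) {φ} := by
      refine hθ.disjoint hφ ?_
      rintro y ⟨h1, h2⟩
      rw [segment_eq_image'] at hx h1 h2
      obtain ⟨c, ⟨hc0, hc1⟩, rfl⟩ := hx
      obtain ⟨d, ⟨hd0, hd1⟩, rfl⟩ := h1
      obtain ⟨k, ⟨hk0, hk1⟩, h⟩ := h2
      have hab : b - a ≠ 0 := by
        intro h0; simp [h0] at ha
      have h3 : (k * (1 - c) + d * c) • (b - a) = 0 := by
        have e1 := congrArg Prod.fst h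
        have e2 := congrArg Prod.snd h
        simp at e1 e2
        ext
        · simp only [Prod.smul_fst, Prod.fst_sub, smul_eq_mul, Prod.fst_zero]
          linear_combination e1
        · simp only [Prod.smul_snd, Prod.snd_sub, smul_eq_mul, Prod.snd_zero]
          linear_combination e2
      have h4 := (smul_eq_zero.mp h3).resolve_right hab
      have hd : d * c = 0 := by nlinarith [mul_nonneg hk0 (sub_nonneg.2 hc1), mul_nonneg hd0 hc0]
      have hc : c ≠ 0 := by rintro rfl; simp at ha
      have : d = 0 := by simpa [hc] using hd
      simp [this]
    simpa using hd
  · rw [segment_eq_union_of_mem hx, ← singleton_union]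
    exact hθ.union hφ

theorem polyline_pair (a b : ℝ × ℝ) : polyline [a, b] = segment ℝ a b :=
  union_eq_left.mpr (singleton_subset_iff.mpr (right_mem_segment ℝ a b))

theorem isClosed_segment (a b : ℝ × ℝ) : IsClosed (segment ℝ a b) := by
  rw [segment_eq_image']
  exact (isCompact_Icc.image (by fun_prop)).isClosed

theorem isClosed_polyline (l : List (ℝ × ℝ)) : IsClosed (polyline l) := by
  induction l with
  | nil => exact isClosed_empty
  | cons a l ih =>
    cases l with
    | nil => exact isClosed_singleton
    | cons b l => exact (isClosed_segment a b).union ih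

theorem head_mem_polyline (a : ℝ × ℝ) (l : List (ℝ × ℝ)) : a ∈ polyline (a :: l) := by
  cases l with
  | nil => rfl
  | cons b l => exact Or.inl (left_mem_segment ℝ a b)

theorem last_mem_polyline {l : List (ℝ × ℝ)} {q : ℝ × ℝ} (h : l.getLast? = some q) :
    q ∈ polyline l := by
  induction l with
  | nil => simp at h
  | cons a l ih =>
    cases l with
    | nil => simp at h; simp [polyline, h]
    | cons b l => exact Or.inr (ih (by simpa using h))

theorem notMem_polyline_tail {a b : ℝ × ℝ} {l : List (ℝ × ℝ)}
    (h : IsSimplePolyline (a :: b :: l)) : a ∉ polyline (b :: l) := by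
  intro ha
  have : a ∈ segment ℝ a b ∩ polyline (b :: l) := ⟨left_mem_segment ℝ a b, ha⟩
  rw [h.2.1] at this
  exact h.1 this

theorem head_ne_last {a b q : ℝ × ℝ} {l : List (ℝ × ℝ)}
    (h : IsSimplePolyline (a :: b :: l)) (hq : (b :: l).getLast? = some q) : a ≠ q := by
  rintro rfl
  exact notMem_polyline_tail h (last_mem_polyline hq)

/-- A simple polygonal line leaves its endpoints in one direction and its other points in two. -/
theorem IsSimplePolyline.conicAt {a b q : ℝ × ℝ} {l : List (ℝ × ℝ)}
    (h : IsSimplePolyline (a :: b :: l)) (hq : (b :: l).getLast? = some q) :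
    (∃ θ, ConicAt (polyline (a :: b :: l)) a {θ}) ∧
    (∃ θ, ConicAt (polyline (a :: b :: l)) q {θ}) ∧
    ∀ x ∈ polyline (a :: b :: l), x ≠ a → x ≠ q →
      ∃ θ φ, θ ≠ φ ∧ ConicAt (polyline (a :: b :: l)) x {θ, φ} := by
  have hstart : ∃ θ, ConicAt (polyline (a :: b :: l)) a {θ} := by
    obtain ⟨θ, hθ⟩ := conicAt_segment_endpoint h.1
    refine ⟨θ, ?_⟩
    rw [← union_empty {θ}]
    exact hθ.union (conicAt_empty_of_notMem (isClosed_polyline _) (notMem_polyline_tail h))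
  refine ⟨hstart, ?_⟩
  clear hstart
  induction l generalizing a b with
  | nil =>
    obtain rfl : b = q := by simpa using hq
    rw [polyline_pair]
    refine ⟨?_, fun x hx ha hb => conicAt_segment_interior hx ha hb⟩
    rw [segment_symm]
    exact conicAt_segment_endpoint h.1.symm
  | cons c l ih =>
    have hs' := h.2.2
    have hq' : (c :: l).getLast? = some q := by simpa using hq
    have hbq : b ≠ q := head_ne_last hs' hq'
    have hmeet : ∀ x ∈ segment ℝ a b, x ∈ polyline (b :: c :: l) → x = b := fun x h1 h2 => by
      have : x ∈ segment ℝ a b ∩ polyline (b :: c :: l) := ⟨h1, h2⟩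
      rw [h.2.1] at this; exact this
    obtain ⟨⟨θ, hθ⟩, hint⟩ := ih hs' hq'
    refine ⟨⟨θ, ?_⟩, ?_⟩
    · rw [← empty_union {θ}]
      refine (conicAt_empty_of_notMem (isClosed_segment a b) fun hqs => hbq ?_).union hθ
      exact (hmeet q hqs (last_mem_polyline hq)).symm
    · intro x hx hxa hxq
      by_cases hseg : x ∈ segment ℝ a b
      · by_cases hxb : x = b
        · subst hxb
          obtain ⟨φ, hφ⟩ := conicAt_segment_endpoint h.1.symm
          rw [segment_symm] at hφ
          obtain ⟨ψ, hψ⟩ : ∃ ψ, ConicAt (polyline (x :: c :: l)) x {ψ} := by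
            obtain ⟨ψ, hψ⟩ := conicAt_segment_endpoint hs'.1
            refine ⟨ψ, ?_⟩
            rw [← union_empty {ψ}]
            exact hψ.union
              (conicAt_empty_of_notMem (isClosed_polyline _) (notMem_polyline_tail hs'))
          have hd := hφ.disjoint hψ h.2.1.subset
          refine ⟨φ, ψ, by simpa using hd, ?_⟩
          rw [← singleton_union]
          exact hφ.union hψ
        · obtain ⟨φ, ψ, hne, hc⟩ := conicAt_segment_interior hseg hxa hxb
          refine ⟨φ, ψ, hne, ?_⟩
          rw [← union_empty {φ, ψ}]
          exact hc.union (conicAt_empty_of_notMem (isClosed_polyline _)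
            fun h2 => hxb (hmeet x hseg h2))
      · have hx' : x ∈ polyline (b :: c :: l) := hx.resolve_left hseg
        have hxb : x ≠ b := fun e => hseg (e ▸ right_mem_segment ℝ a b)
        obtain ⟨φ, ψ, hne, hc⟩ := hint x hx' hxb hxq
        refine ⟨φ, ψ, hne, ?_⟩
        rw [← empty_union {φ, ψ}]
        exact (conicAt_empty_of_notMem (isClosed_segment a b) hseg).union hc

theorem convex_segment_diff_right (a b : ℝ × ℝ) : Convex ℝ (segment ℝ a b \ {b}) := by
  by_cases hab : a = b
  · subst hab; simp [convex_empty]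
  have hinj : ∀ c : ℝ, a + c • (b - a) = b → c = 1 := by
    intro c hc
    have h0 : (c - 1) • (b - a) = 0 := by
      have : c • (b - a) = b - a := by rw [eq_sub_iff_add_eq, add_comm]; exact hc
      rw [sub_smul, this, one_smul, sub_self]
    have := (smul_eq_zero.mp h0).resolve_right (sub_ne_zero.mpr (Ne.symm hab))
    linarith
  have : segment ℝ a b \ {b} = (fun c : ℝ => a + c • (b - a)) '' Ico 0 1 := by
    rw [segment_eq_image']
    ext y
    constructor
    · rintro ⟨⟨c, ⟨h0, h1⟩, rfl⟩, hy⟩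
      refine ⟨c, ⟨h0, lt_of_le_of_ne h1 ?_⟩, rfl⟩
      rintro rfl; simp at hy
    · rintro ⟨c, ⟨h0, h1⟩, rfl⟩
      exact ⟨⟨c, ⟨h0, h1.le⟩, rfl⟩, fun h => h1.ne (hinj c h)⟩
  rw [this]
  have h2 : (fun c : ℝ => a + c • (b - a)) = AffineMap.lineMap (k := ℝ) a b := by
    ext c <;> simp [AffineMap.lineMap_apply] <;> ring
  rw [h2]
  exact (convex_Ico (𝕜 := ℝ) 0 1).affine_image (AffineMap.lineMap (k := ℝ) a b)

theorem isPreconnected_polyline_diff_last {l : List (ℝ × ℝ)} (h : IsSimplePolyline l)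
    {q : ℝ × ℝ} (hq : l.getLast? = some q) : IsPreconnected (polyline l \ {q}) := by
  induction l with
  | nil => simp at hq
  | cons a l ih =>
    cases l with
    | nil =>
      obtain rfl : a = q := by simpa using hq
      simp [polyline, isPreconnected_empty]
    | cons b l =>
      have hq' : (b :: l).getLast? = some q := by simpa using hq
      by_cases hbq : b = q
      · subst hbq
        cases l with
        | nil =>
          rw [polyline_pair]
          exact (convex_segment_diff_right a b).isPreconnected
        | cons c l =>
          exact absurd rfl (head_ne_last h.2.2 (by simpa using hq'))
      · have hqs : q ∉ segment ℝ a b := fun hs => by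
          have : q ∈ segment ℝ a b ∩ polyline (b :: l) := ⟨hs, last_mem_polyline hq'⟩
          rw [h.2.1] at this
          exact hbq this.symm
        rw [polyline, union_sdiff_distrib, sdiff_singleton_eq_self hqs]
        exact IsPreconnected.union b (right_mem_segment ℝ a b) ⟨head_mem_polyline b l, hbq⟩
          (convex_segment a b).isPreconnected (ih h.2.2 hq')

/-- A simple polygonal line stays connected when its endpoints are removed. -/
theorem isPreconnected_polyline_diff_ends {a b q : ℝ × ℝ} {l : List (ℝ × ℝ)}
    (h : IsSimplePolyline (a :: b :: l)) (hq : (b :: l).getLast? = some q) :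
    IsPreconnected (polyline (a :: b :: l) \ {a, q}) := by
  have hp := isPreconnected_polyline_diff_last h.2.2 hq
  have ha := notMem_polyline_tail h
  have hc : Convex ℝ (segment ℝ a b \ {a}) := by
    rw [segment_symm]; exact convex_segment_diff_right b a
  by_cases hbq : b = q
  · subst hbq
    cases l with
    | nil =>
      rw [polyline_pair]
      have : segment ℝ a b \ {a, b} = (segment ℝ a b \ {a}) ∩ (segment ℝ a b \ {b}) := by
        ext; simp; tauto
      rw [this]
      exact (hc.inter (convex_segment_diff_right a b)).isPreconnected
    | cons c l => exact absurd rfl (head_ne_last h.2.2 (by simpa using hq))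
  · have hqs : q ∉ segment ℝ a b := fun hs => by
      have : q ∈ segment ℝ a b ∩ polyline (b :: l) := ⟨hs, last_mem_polyline hq⟩
      rw [h.2.1] at this
      exact hbq this.symm
    have : polyline (a :: b :: l) \ {a, q} = (segment ℝ a b \ {a}) ∪ (polyline (b :: l) \ {q}) := by
      rw [polyline]
      ext y
      simp only [Set.mem_sdiff, mem_union, mem_insert_iff, mem_singleton_iff, not_or]
      constructor
      · rintro ⟨h1 | h1, h2, h3⟩
        · exact Or.inl ⟨h1, h2⟩
        · exact Or.inr ⟨h1, h3⟩
      · rintro (⟨h1, h2⟩ | ⟨h1, h2⟩)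
        · exact ⟨Or.inl h1, h2, fun e => hqs (e ▸ h1)⟩
        · exact ⟨Or.inr h1, fun e => ha (e ▸ h1), h2⟩
    rw [this]
    exact IsPreconnected.union b ⟨right_mem_segment ℝ a b, h.1.symm⟩
      ⟨head_mem_polyline b l, hbq⟩ hc.isPreconnected hp

/-! ### Circular sectors and the components of a complement -/

theorem continuous_unitVec : Continuous unitVec := by
  unfold unitVec
  exact Real.Angle.continuous_cos.prodMk Real.Angle.continuous_sin

/-- The open circular sector of radius `r` at `x` between the directions `α` and `β`. -/
def sector (x : ℝ × ℝ) (r α β : ℝ) : Set (ℝ × ℝ) :=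
  (fun p : ℝ × ℝ => x + p.1 • unitVec (p.2 : Real.Angle)) '' Ioo 0 r ×ˢ Ioo α β

theorem continuous_polar (x : ℝ × ℝ) :
    Continuous fun p : ℝ × ℝ => x + p.1 • unitVec (p.2 : Real.Angle) :=
  continuous_const.add
    (continuous_fst.smul (continuous_unitVec.comp (Real.Angle.continuous_coe.comp continuous_snd)))

theorem isPreconnected_sector (x : ℝ × ℝ) (r α β : ℝ) : IsPreconnected (sector x r α β) :=
  (isPreconnected_Ioo.prod isPreconnected_Ioo).image _ (continuous_polar x).continuousOn

theorem mem_sector {x : ℝ × ℝ} {r α β t θ : ℝ} (ht : 0 < t) (ht' : t < r) (hα : α < θ)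
    (hβ : θ < β) : x + t • unitVec (θ : Real.Angle) ∈ sector x r α β :=
  ⟨(t, θ), ⟨⟨ht, ht'⟩, hα, hβ⟩, rfl⟩

theorem mem_closure_sector {x : ℝ × ℝ} {r α β t θ : ℝ} (hr : 0 < r) (hαβ : α < β) (ht : 0 ≤ t)
    (ht' : t ≤ r) (hα : α ≤ θ) (hβ : θ ≤ β) :
    x + t • unitVec (θ : Real.Angle) ∈ closure (sector x r α β) := by
  apply image_closure_subset_closure_image (continuous_polar x)
  refine ⟨(t, θ), ?_, rfl⟩
  rw [closure_prod_eq, closure_Ioo hr.ne, closure_Ioo hαβ.ne]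
  exact ⟨⟨ht, ht'⟩, hα, hβ⟩

/-- A sector between two neighbouring radii of `K` does not meet `K`. -/
theorem sector_subset_compl {K : Set (ℝ × ℝ)} {x : ℝ × ℝ} {r α β : ℝ} {D : Set Real.Angle}
    (h : ∀ t : ℝ, 0 < t → t < r → ∀ θ, x + t • unitVec θ ∈ K ↔ θ ∈ D)
    (hD : ∀ θ : ℝ, α < θ → θ < β → (θ : Real.Angle) ∉ D) : sector x r α β ⊆ Kᶜ := by
  rintro _ ⟨⟨t, θ⟩, ⟨⟨ht, ht'⟩, hα, hβ⟩, rfl⟩ hK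
  exact hD θ hα hβ ((h t ht ht' θ).1 hK)

theorem exists_coe_eq_mem_Ioc (a : ℝ) (θ : Real.Angle) :
    ∃ b : ℝ, (b : Real.Angle) = θ ∧ a < b ∧ b ≤ a + 2 * Real.pi := by
  induction θ using Real.Angle.induction_on with | h θ =>
  have h := toIocMod_mem_Ioc Real.two_pi_pos a θ
  refine ⟨toIocMod Real.two_pi_pos a θ, ?_, h.1, h.2⟩
  exact Real.Angle.coe_toIocMod θ a

/-- A direction outside a finite nonempty set of directions lies in a gap between two members of
the set; they are the same direction only if the set is a singleton. -/
theorem exists_gap {D : Set Real.Angle} (hD : D.Finite) (hne : D.Nonempty) {θ : ℝ}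
    (hθ : (θ : Real.Angle) ∉ D) :
    ∃ α β : ℝ, α < θ ∧ θ < β ∧ (α : Real.Angle) ∈ D ∧ (β : Real.Angle) ∈ D ∧
      (∀ γ : ℝ, α < γ → γ < β → (γ : Real.Angle) ∉ D) ∧
      (D.Nontrivial → (α : Real.Angle) ≠ β) := by
  set S : Set ℝ := {γ | (γ : Real.Angle) ∈ D} with hS
  have hSc : IsClosed S := hD.isClosed.preimage Real.Angle.continuous_coe
  obtain ⟨d, hd⟩ := hne
  have hper : ((2 * Real.pi : ℝ) : Real.Angle) = 0 := Real.Angle.coe_two_pi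
  obtain ⟨b, hbd, hb1, hb2⟩ := exists_coe_eq_mem_Ioc θ d
  obtain ⟨β, ⟨hβS, hβ1, hβ2⟩, hβ⟩ := (isCompact_Icc.inter_left hSc :
    IsCompact (S ∩ Icc θ (θ + 2 * Real.pi))).exists_isLeast
      ⟨b, show (b : Real.Angle) ∈ D from hbd ▸ hd, hb1.le, hb2⟩
  obtain ⟨α, ⟨hαS, hα1, hα2⟩, hα⟩ := (isCompact_Icc.inter_left hSc :
    IsCompact (S ∩ Icc (θ - 2 * Real.pi) θ)).exists_isGreatest
      ⟨b - 2 * Real.pi, by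
        show ((b - 2 * Real.pi : ℝ) : Real.Angle) ∈ D
        rw [Real.Angle.coe_sub, hper, sub_zero, hbd]; exact hd, by linarith, by linarith⟩
  have hαθ : α < θ := lt_of_le_of_ne hα2 (by rintro rfl; exact hθ hαS)
  have hθβ : θ < β := lt_of_le_of_ne hβ1 (by rintro rfl; exact hθ hβS)
  have hgap : ∀ γ : ℝ, α < γ → γ < β → (γ : Real.Angle) ∉ D := by
    intro γ h1 h2 hγ
    rcases le_total γ θ with h | h
    · exact (hα ⟨hγ, by linarith, h⟩).not_gt h1
    · exact (hβ ⟨hγ, h, by linarith⟩).not_gt h2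
  refine ⟨α, β, hαθ, hθβ, hαS, hβS, hgap, ?_⟩
  intro hnt heq
  obtain ⟨e, heD, hne⟩ := hnt.exists_ne (α : Real.Angle)
  obtain ⟨γ, hγe, h1, h2⟩ := exists_coe_eq_mem_Ioc α e
  obtain ⟨k, hk⟩ := Real.Angle.angle_eq_iff_two_pi_dvd_sub.1 heq.symm
  have hk0 : 0 < k := by
    by_contra! hk0
    have : (k : ℝ) ≤ 0 := by exact_mod_cast hk0
    nlinarith [Real.pi_pos]
  have hk1 : (1 : ℝ) ≤ k := by exact_mod_cast hk0
  have hγ2 : γ < α + 2 * Real.pi := lt_of_le_of_ne h2 (by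
    rintro rfl
    apply hne
    rw [← hγe, Real.Angle.coe_add, hper, add_zero])
  exact hgap γ h1 (by nlinarith [Real.pi_pos]) (hγe ▸ heD)

/-- `F` is a connected component of the complement of `K`. -/
def IsComplComponent (K F : Set (ℝ × ℝ)) : Prop :=
  ∃ x ∈ Kᶜ, F = connectedComponentIn Kᶜ x

namespace IsComplComponent

variable {K F F' : Set (ℝ × ℝ)}

theorem subset_compl (hF : IsComplComponent K F) : F ⊆ Kᶜ := by
  obtain ⟨x, -, rfl⟩ := hF
  exact connectedComponentIn_subset _ _

theorem nonempty (hF : IsComplComponent K F) : F.Nonempty := by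
  obtain ⟨x, hx, rfl⟩ := hF
  exact ⟨x, mem_connectedComponentIn hx⟩

theorem isPreconnected (hF : IsComplComponent K F) : IsPreconnected F := by
  obtain ⟨x, -, rfl⟩ := hF
  exact isPreconnected_connectedComponentIn

theorem isOpen (hK : IsClosed K) (hF : IsComplComponent K F) : IsOpen F := by
  obtain ⟨x, -, rfl⟩ := hF
  exact hK.isOpen_compl.connectedComponentIn

theorem subset_of_isPreconnected (hF : IsComplComponent K F) {S : Set (ℝ × ℝ)}
    (hS : IsPreconnected S) (hSK : S ⊆ Kᶜ) (h : (S ∩ F).Nonempty) : S ⊆ F := by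
  obtain ⟨x, -, rfl⟩ := hF
  obtain ⟨y, hyS, hyF⟩ := h
  rw [connectedComponentIn_eq hyF]
  exact hS.subset_connectedComponentIn hyS hSK

theorem eq_of_inter (hF : IsComplComponent K F) (hF' : IsComplComponent K F')
    (h : (F ∩ F').Nonempty) : F = F' :=
  (hF'.subset_of_isPreconnected hF.isPreconnected hF.subset_compl h).antisymm
    (hF.subset_of_isPreconnected hF'.isPreconnected hF'.subset_compl (inter_comm F F' ▸ h))

theorem eq_of_subset (hF : IsComplComponent K F) (hF' : IsComplComponent K F') {S : Set (ℝ × ℝ)}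
    (hS : IsPreconnected S) (hSK : S ⊆ Kᶜ) (h : (S ∩ F).Nonempty) (h' : (S ∩ F').Nonempty) :
    F = F' := by
  obtain ⟨y, hy, hyF⟩ := h
  exact hF.eq_of_inter hF' ⟨y, hyF, hF'.subset_of_isPreconnected hS hSK h' hy⟩

theorem eq_of_mem_closure (hK : IsClosed K) (hF : IsComplComponent K F)
    (hF' : IsComplComponent K F') {x : ℝ × ℝ} (h : x ∈ F') (hx : x ∈ closure F) : F = F' :=
  hF.eq_of_inter hF' (by
    obtain ⟨y, hy, hy'⟩ := mem_closure_iff.1 hx F' (hF'.isOpen hK) h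
    exact ⟨y, hy', hy⟩)

theorem mem_frontier_iff (hK : IsClosed K) (hF : IsComplComponent K F) {x : ℝ × ℝ}
    (hx : x ∈ K) : x ∈ frontier F ↔ x ∈ closure F := by
  rw [frontier, (hF.isOpen hK).interior_eq]
  exact ⟨fun h => h.1, fun h => ⟨h, fun hxF => hF.subset_compl hxF hx⟩⟩

theorem frontier_subset (hK : IsClosed K) (hF : IsComplComponent K F) : frontier F ⊆ K := by
  intro x hx
  by_contra hxK
  have hx' : IsComplComponent K (connectedComponentIn Kᶜ x) := ⟨x, hxK, rfl⟩
  have hmem := mem_connectedComponentIn (F := Kᶜ) hxK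
  rw [← hF.eq_of_mem_closure hK hx' hmem hx.1] at hmem
  exact hx.2 ((hF.isOpen hK).interior_eq.symm ▸ hmem)

end IsComplComponent

/-- The Euclidean discs around `x` are neighbourhoods of `x` in `ℝ × ℝ`, which carries the sup norm.
-/
theorem polar_mem_nhds (x : ℝ × ℝ) {r : ℝ} (hr : 0 < r) :
    {y | ∃ t θ, 0 ≤ t ∧ t < r ∧ y = x + t • unitVec θ} ∈ 𝓝 x := by
  refine mem_of_superset (Metric.ball_mem_nhds x (half_pos hr)) fun y hy => ?_
  by_cases hyx : y = x
  · exact ⟨0, 0, le_rfl, hr, by simp [hyx]⟩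
  obtain ⟨s, θ, hs, h⟩ := exists_eq_smul_unitVec (sub_ne_zero.mpr hyx)
  refine ⟨s, θ, hs.le, ?_, by rw [← h]; abel⟩
  rw [Metric.mem_ball, dist_eq_norm, h, norm_smul, Real.norm_of_nonneg hs.le, Prod.norm_def] at hy
  simp only [unitVec, Real.norm_eq_abs] at hy
  have e := θ.cos_sq_add_sin_sq
  by_contra! hsr
  have h1 := mul_le_mul_of_nonneg_left (le_max_left |θ.cos| |θ.sin|) hs.le
  have h2 := mul_le_mul_of_nonneg_left (le_max_right |θ.cos| |θ.sin|) hs.le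
  have h3 : |θ.cos| < 1 / 2 := by
    by_contra! h
    nlinarith
  have h4 : |θ.sin| < 1 / 2 := by
    by_contra! h
    nlinarith
  rw [abs_lt] at h3 h4
  nlinarith

theorem IsComplComponent.exists_mem_near {K F : Set (ℝ × ℝ)} {x : ℝ × ℝ} (hx : x ∈ K)
    (hF : IsComplComponent K F) (hxF : x ∈ closure F) {r : ℝ} (hr : 0 < r) :
    ∃ t θ, 0 < t ∧ t < r ∧ x + t • unitVec θ ∈ F := by
  obtain ⟨y, ⟨t, θ, ht, ht', rfl⟩, hyF⟩ := mem_closure_iff_nhds.1 hxF _ (polar_mem_nhds x hr)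
  refine ⟨t, θ, lt_of_le_of_ne ht ?_, ht', hyF⟩
  rintro rfl
  exact hF.subset_compl hyF (by simpa using hx)

/-- A component of the complement of `K` at `x` contains a sector between two radii of `K`. -/
theorem ConicAt.exists_corner {K F : Set (ℝ × ℝ)} {x : ℝ × ℝ} {D : Set Real.Angle}
    (h : ConicAt K x D) (hfin : D.Finite) (hx : x ∈ K) (hD : D.Nonempty)
    (hF : IsComplComponent K F) (hxF : x ∈ closure F) :
    ∃ α ∈ D, ∃ β ∈ D, (D.Nontrivial → α ≠ β) ∧ ∃ r > 0, ∀ t : ℝ, 0 < t → t < r →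
      x + t • unitVec α ∈ closure F ∧ x + t • unitVec β ∈ closure F := by
  obtain ⟨r, hr, h⟩ := h
  obtain ⟨t, θ, ht, ht', hmem⟩ := IsComplComponent.exists_mem_near hx hF hxF hr
  have hθ : θ ∉ D := fun hθ => hF.subset_compl hmem ((h t ht ht' θ).2 hθ)
  induction θ using Real.Angle.induction_on with | h θ =>
  obtain ⟨α, β, hα, hβ, hαD, hβD, hgap, hne⟩ := exists_gap hfin hD hθ
  have hsub : sector x r α β ⊆ F := hF.subset_of_isPreconnected (isPreconnected_sector _ _ _ _)
    (sector_subset_compl h hgap) ⟨_, mem_sector ht ht' hα hβ, hmem⟩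
  refine ⟨α, hαD, β, hβD, hne, r, hr, fun t ht ht' => ⟨?_, ?_⟩⟩
  · exact closure_mono hsub
      (mem_closure_sector hr (hα.trans hβ) ht.le ht'.le le_rfl (hα.trans hβ).le)
  · exact closure_mono hsub
      (mem_closure_sector hr (hα.trans hβ) ht.le ht'.le (hα.trans hβ).le le_rfl)

/-- Around an isolated point or an end of an edge there is only one component. -/
theorem ConicAt.component_unique {K F F' : Set (ℝ × ℝ)} {x : ℝ × ℝ} {D : Set Real.Angle}
    (h : ConicAt K x D) (hx : x ∈ K) (hD : D.Subsingleton) (hF : IsComplComponent K F)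
    (hxF : x ∈ closure F) (hF' : IsComplComponent K F') (hxF' : x ∈ closure F') : F = F' := by
  obtain ⟨r, hr, h⟩ := h
  obtain ⟨t, θ, ht, ht', hmem⟩ := IsComplComponent.exists_mem_near hx hF hxF hr
  obtain ⟨s, φ, hs, hs', hmem'⟩ := IsComplComponent.exists_mem_near hx hF' hxF' hr
  have hθ : θ ∉ D := fun hθ => hF.subset_compl hmem ((h t ht ht' θ).2 hθ)
  have hφ : φ ∉ D := fun hφ => hF'.subset_compl hmem' ((h s hs hs' φ).2 hφ)
  have hper : ((2 * Real.pi : ℝ) : Real.Angle) = 0 := Real.Angle.coe_two_pi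
  -- a single sector contains all directions off `D`
  obtain ⟨a, b, hgap, hin⟩ : ∃ a b : ℝ, (∀ γ : ℝ, a < γ → γ < b → (γ : Real.Angle) ∉ D) ∧
      ∀ ψ : Real.Angle, ψ ∉ D → ∃ γ : ℝ, (γ : Real.Angle) = ψ ∧ a < γ ∧ γ < b := by
    rcases hD.eq_empty_or_singleton with rfl | ⟨α, rfl⟩
    · refine ⟨0, 2 * Real.pi + 1, by simp, fun ψ _ => ?_⟩
      obtain ⟨γ, h1, h2, h3⟩ := exists_coe_eq_mem_Ioc 0 ψ
      exact ⟨γ, h1, h2, by linarith⟩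
    · induction α using Real.Angle.induction_on with | h α =>
      refine ⟨α, α + 2 * Real.pi, fun γ h1 h2 heq => ?_, fun ψ hψ => ?_⟩
      · obtain ⟨k, hk⟩ := Real.Angle.angle_eq_iff_two_pi_dvd_sub.1 heq
        have hk1 : 0 < k := by
          by_contra! hk0
          have : (k : ℝ) ≤ 0 := by exact_mod_cast hk0
          nlinarith [Real.pi_pos]
        have hk1' : (1 : ℝ) ≤ k := by exact_mod_cast hk1
        nlinarith [Real.pi_pos]
      · obtain ⟨γ, h1, h2, h3⟩ := exists_coe_eq_mem_Ioc α ψ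
        refine ⟨γ, h1, h2, lt_of_le_of_ne h3 ?_⟩
        rintro rfl
        rw [Real.Angle.coe_add, hper, add_zero] at h1
        exact hψ h1.symm
  obtain ⟨θ, rfl, h1, h2⟩ := hin θ hθ
  obtain ⟨φ, rfl, h3, h4⟩ := hin φ hφ
  exact hF.eq_of_subset hF' (isPreconnected_sector x r a b) (sector_subset_compl h hgap)
    ⟨_, mem_sector ht ht' h1 h2, hmem⟩ ⟨_, mem_sector hs hs' h3 h4, hmem'⟩

/-- Around a point with two directions there are at most two components. -/
theorem ConicAt.component_eq_or {K : Set (ℝ × ℝ)} {x : ℝ × ℝ} {α β : Real.Angle}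
    (hαβ : α ≠ β) (h : ConicAt K x {α, β}) (hx : x ∈ K) {F : Fin 3 → Set (ℝ × ℝ)}
    (hF : ∀ i, IsComplComponent K (F i)) (hxF : ∀ i, x ∈ closure (F i)) :
    ∃ i j, i ≠ j ∧ F i = F j := by
  obtain ⟨r, hr, h⟩ := h
  choose t θ ht ht' hmem using fun i => IsComplComponent.exists_mem_near hx (hF i) (hxF i) hr
  have hθ : ∀ i, θ i ∉ ({α, β} : Set _) := fun i hθ =>
    (hF i).subset_compl (hmem i) ((h (t i) (ht i) (ht' i) (θ i)).2 hθ)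
  have hper : ((2 * Real.pi : ℝ) : Real.Angle) = 0 := Real.Angle.coe_two_pi
  induction α using Real.Angle.induction_on with | h α =>
  obtain ⟨β, rfl, hβ1, hβ2⟩ := exists_coe_eq_mem_Ioc α β
  have hβ2 : β < α + 2 * Real.pi := lt_of_le_of_ne hβ2 (by
    rintro rfl
    rw [Real.Angle.coe_add, hper, add_zero] at hαβ
    exact hαβ rfl)
  have huniq : ∀ γ δ : ℝ, (γ : Real.Angle) = δ → |γ - δ| < 2 * Real.pi → γ = δ := by
    intro γ δ heq hlt
    obtain ⟨k, hk⟩ := Real.Angle.angle_eq_iff_two_pi_dvd_sub.1 heq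
    rw [hk, abs_mul, abs_of_pos Real.two_pi_pos] at hlt
    have h1 : |(k : ℝ)| < 1 := by
      by_contra! h1
      nlinarith [Real.pi_pos]
    have : k = 0 := Int.abs_lt_one_iff.1 (by exact_mod_cast h1)
    rw [this] at hk
    simp at hk
    linarith
  have hgap1 : ∀ γ : ℝ, α < γ → γ < β → (γ : Real.Angle) ∉ ({↑α, ↑β} : Set Real.Angle) := by
    rintro γ h1 h2 (heq | heq)
    · exact h1.ne' (huniq _ _ heq (abs_lt.2 ⟨by linarith, by linarith⟩))
    · exact h2.ne (huniq _ _ heq (abs_lt.2 ⟨by linarith, by linarith⟩))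
  have hgap2 : ∀ γ : ℝ, β < γ → γ < α + 2 * Real.pi →
      (γ : Real.Angle) ∉ ({↑α, ↑β} : Set Real.Angle) := by
    rintro γ h1 h2 (heq | heq)
    · exact (hβ1.trans h1).ne' (huniq _ _ heq (abs_lt.2 ⟨by linarith, by linarith⟩))
    · exact h1.ne' (huniq _ _ heq (abs_lt.2 ⟨by linarith, by linarith⟩))
  have hcase : ∀ i, (sector x r α β ∩ F i).Nonempty ∨
      (sector x r β (α + 2 * Real.pi) ∩ F i).Nonempty := by
    intro i
    obtain ⟨γ, h1, h2, h3⟩ := exists_coe_eq_mem_Ioc α (θ i)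
    have hi := hθ i
    have hmi := hmem i
    rw [← h1] at hi hmi
    have h3 : γ < α + 2 * Real.pi := lt_of_le_of_ne h3 (by
      rintro rfl
      rw [Real.Angle.coe_add, hper, add_zero] at hi
      exact hi (Or.inl rfl))
    rcases lt_trichotomy γ β with h4 | rfl | h4
    · exact Or.inl ⟨_, mem_sector (ht i) (ht' i) h2 h4, hmi⟩
    · exact absurd (Or.inr rfl) hi
    · exact Or.inr ⟨_, mem_sector (ht i) (ht' i) h4 h3, hmi⟩
  classical
  -- two of the three components meet the same one of the two sectors
  obtain ⟨i, j, hij, hc⟩ := Fintype.exists_ne_map_eq_of_card_lt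
    (fun i => decide (sector x r α β ∩ F i).Nonempty) (by simp)
  refine ⟨i, j, hij, ?_⟩
  by_cases hi : (sector x r α β ∩ F i).Nonempty
  · have hj : (sector x r α β ∩ F j).Nonempty := by simpa [hi] using hc
    exact (hF i).eq_of_subset (hF j) (isPreconnected_sector _ _ _ _)
      (sector_subset_compl h hgap1) hi hj
  · have hj : ¬(sector x r α β ∩ F j).Nonempty := by simpa [hi] using hc
    exact (hF i).eq_of_subset (hF j) (isPreconnected_sector _ _ _ _)
      (sector_subset_compl h hgap2) ((hcase i).resolve_left hi) ((hcase j).resolve_left hj)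

/-- Every component that comes close to `x` has `x` in its closure. -/
theorem ConicAt.exists_forall_mem_closure {K : Set (ℝ × ℝ)} {x : ℝ × ℝ} {D : Set Real.Angle}
    (h : ConicAt K x D) (hfin : D.Finite) : ∃ r > (0 : ℝ), ∀ F, IsComplComponent K F →
      ∀ t : ℝ, ∀ θ, 0 < t → t < r → x + t • unitVec θ ∈ F → x ∈ closure F := by
  obtain ⟨r, hr, h⟩ := h
  refine ⟨r, hr, fun F hF t θ ht ht' hmem => ?_⟩
  have hθ : θ ∉ D := fun hθ => hF.subset_compl hmem ((h t ht ht' θ).2 hθ)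
  obtain ⟨α, β, γ, h1, h2, rfl, hgap⟩ : ∃ α β γ : ℝ, α < γ ∧ γ < β ∧ (γ : Real.Angle) = θ ∧
      ∀ γ : ℝ, α < γ → γ < β → (γ : Real.Angle) ∉ D := by
    induction θ using Real.Angle.induction_on with | h θ =>
    rcases D.eq_empty_or_nonempty with rfl | hne
    · exact ⟨θ - 1, θ + 1, θ, by linarith, by linarith, rfl, by simp⟩
    · obtain ⟨α, β, hα, hβ, -, -, hgap, -⟩ := exists_gap hfin hne hθ
      exact ⟨α, β, θ, hα, hβ, rfl, hgap⟩
  have hsub : sector x r α β ⊆ F := hF.subset_of_isPreconnected (isPreconnected_sector _ _ _ _)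
    (sector_subset_compl h hgap) ⟨_, mem_sector ht ht' h1 h2, hmem⟩
  simpa using closure_mono hsub
    (mem_closure_sector hr (h1.trans h2) le_rfl hr.le h1.le h2.le)

/-- If only one component comes close to `x`, then its closure is a neighbourhood of `x`. -/
theorem ConicAt.closure_mem_nhds {K F : Set (ℝ × ℝ)} {x : ℝ × ℝ} {D : Set Real.Angle}
    (h : ConicAt K x D) (hfin : D.Finite) (hxF : x ∈ closure F)
    (huniq : ∀ F', IsComplComponent K F' → x ∈ closure F' → F' = F) : closure F ∈ 𝓝 x := by
  obtain ⟨r, hr, hcl⟩ := h.exists_forall_mem_closure hfin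
  obtain ⟨r', hr', h⟩ := h
  refine mem_of_superset (polar_mem_nhds x (lt_min hr hr')) ?_
  rintro y ⟨t, θ, ht, ht', rfl⟩
  rcases ht.eq_or_lt with rfl | ht
  · simpa using hxF
  have : ConnectedSpace Real.Angle := Function.Surjective.connectedSpace
    (f := ((↑) : ℝ → Real.Angle)) (fun ψ => Real.Angle.induction_on ψ fun γ => ⟨γ, rfl⟩)
    Real.Angle.continuous_coe
  have : Nontrivial Real.Angle := ⟨_, _, Real.Angle.pi_ne_zero⟩
  -- the points of `K` near `x` are limits of points off `K` at the same distance from `x`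
  have hd : Dense (univ \ D) := dense_univ.sdiff_finite hfin
  have hc : Continuous fun φ => x + t • unitVec φ :=
    continuous_const.add (continuous_unitVec.const_smul t)
  refine closure_mono ?_ (image_closure_subset_closure_image hc ⟨θ, hd θ, rfl⟩)
  rintro _ ⟨φ, ⟨-, hφ⟩, rfl⟩
  have hK : x + t • unitVec φ ∈ Kᶜ := fun hm =>
    hφ ((h t ht (ht'.trans_le (min_le_right _ _)) φ).1 hm)
  have hcomp : IsComplComponent K (connectedComponentIn Kᶜ (x + t • unitVec φ)) := ⟨_, hK, rfl⟩
  have hmem := mem_connectedComponentIn hK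
  rwa [huniq _ hcomp (hcl _ hcomp t φ ht (ht'.trans_le (min_le_left _ _)) hmem)] at hmem

/-! ### Faces at the edges and vertices of a drawing -/

namespace PlaneDrawing

variable {V : Type*} {G : SimpleGraph V} (D : PlaneDrawing G)

/-- The arc of the edge `e` without its ends. -/
def openArc (e : Sym2 V) : Set (ℝ × ℝ) := D.arc e \ range D.point

/-- The polygonal line of an edge has at least two points, since the ends are distinct. -/
theorem exists_polyline {e : Sym2 V} (he : e ∈ G.edgeSet) : ∃ u v a b l,
    e = s(u, v) ∧ u ≠ v ∧ IsSimplePolyline (a :: b :: l) ∧ a = D.point u ∧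
      (b :: l).getLast? = some (D.point v) ∧ polyline (a :: b :: l) = D.arc e := by
  obtain ⟨u, v, rfl, l, hl, hu, hv, harc⟩ := D.arc_isPolygonalArc e he
  have huv : u ≠ v := G.ne_of_adj he
  match l, hl, hu, hv, harc with
  | [a], _, hu, hv, _ =>
    have h1 : a = D.point u := by simpa using hu
    have h2 : a = D.point v := by simpa using hv
    exact absurd (D.point_injective (h1.symm.trans h2)) huv
  | a :: b :: l, hl, hu, hv, harc =>
    exact ⟨u, v, a, b, l, rfl, huv, hl, by simpa using hu, by simpa using hv, harc⟩

theorem isClosed_arc {e : Sym2 V} (he : e ∈ G.edgeSet) : IsClosed (D.arc e) := by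
  obtain ⟨u, v, a, b, l, -, -, -, -, -, h⟩ := D.exists_polyline he
  exact h ▸ isClosed_polyline _

theorem point_mem_arc {e : Sym2 V} (he : e ∈ G.edgeSet) {v : V} (hv : v ∈ e) :
    D.point v ∈ D.arc e := by
  obtain ⟨u, w, a, b, l, rfl, -, -, rfl, hq, h⟩ := D.exists_polyline he
  rw [← h]
  rcases Sym2.mem_iff.1 hv with rfl | rfl
  · exact head_mem_polyline _ _
  · exact Or.inr (last_mem_polyline hq)

theorem conicAt_arc_point {e : Sym2 V} (he : e ∈ G.edgeSet) {v : V} (hv : v ∈ e) :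
    ∃ θ, ConicAt (D.arc e) (D.point v) {θ} := by
  obtain ⟨u, w, a, b, l, rfl, -, hs, rfl, hq, h⟩ := D.exists_polyline he
  rw [← h]
  rcases Sym2.mem_iff.1 hv with rfl | rfl
  · exact (hs.conicAt hq).1
  · exact (hs.conicAt hq).2.1

theorem conicAt_arc_openArc {e : Sym2 V} (he : e ∈ G.edgeSet) {x : ℝ × ℝ}
    (hx : x ∈ D.openArc e) : ∃ θ φ, θ ≠ φ ∧ ConicAt (D.arc e) x {θ, φ} := by
  obtain ⟨u, w, a, b, l, rfl, -, hs, rfl, hq, h⟩ := D.exists_polyline he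
  rw [openArc, ← h] at hx
  rw [← h]
  exact (hs.conicAt hq).2.2 x hx.1 (fun h => hx.2 ⟨u, h.symm⟩) (fun h => hx.2 ⟨w, h.symm⟩)

theorem isPreconnected_openArc {e : Sym2 V} (he : e ∈ G.edgeSet) :
    IsPreconnected (D.openArc e) := by
  obtain ⟨u, w, a, b, l, rfl, -, hs, rfl, hq, h⟩ := D.exists_polyline he
  have : D.openArc s(u, w) = polyline (D.point u :: b :: l) \ {D.point u, D.point w} := by
    rw [openArc, h]
    ext y
    constructor
    · rintro ⟨h1, h2⟩
      refine ⟨h1, ?_⟩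
      rintro (rfl | rfl) <;> exact h2 ⟨_, rfl⟩
    · rintro ⟨h1, h2⟩
      refine ⟨h1, ?_⟩
      rintro ⟨v, rfl⟩
      rcases Sym2.mem_iff.1 (D.mem_of_point_mem_arc _ he v h1) with rfl | rfl
      · exact h2 (Or.inl rfl)
      · exact h2 (Or.inr rfl)
  rw [this]
  exact isPreconnected_polyline_diff_ends hs hq

theorem arc_subset_support {e : Sym2 V} (he : e ∈ G.edgeSet) : D.arc e ⊆ D.support :=
  fun _ hx => Or.inr (mem_biUnion he hx)

theorem point_mem_support (v : V) : D.point v ∈ D.support := Or.inl ⟨v, rfl⟩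

variable [Finite V]

theorem isClosed_support : IsClosed D.support :=
  (finite_range D.point).isClosed.union
    (G.edgeSet.toFinite.isClosed_biUnion fun _ he => D.isClosed_arc he)

theorem conicAt_range_point (x : ℝ × ℝ) : ConicAt (range D.point) x ∅ := by
  rw [← biUnion_of_singleton (range D.point)]
  have := ConicAt.biUnion (x := x) (D := fun _ => ∅) (finite_range D.point)
    (A := fun y => ({y} : Set (ℝ × ℝ))) (fun y _ => by
      by_cases hxy : x = y
      · rw [hxy]; exact conicAt_singleton y
      · exact conicAt_empty_of_notMem isClosed_singleton hxy)
  simpa using this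

theorem conicAt_support_openArc {e : Sym2 V} (he : e ∈ G.edgeSet) {x : ℝ × ℝ}
    (hx : x ∈ D.openArc e) : ∃ θ φ, θ ≠ φ ∧ ConicAt D.support x {θ, φ} := by
  classical
  obtain ⟨θ, φ, hne, h⟩ := D.conicAt_arc_openArc he hx
  refine ⟨θ, φ, hne, ?_⟩
  have h2 := (D.conicAt_range_point x).union (ConicAt.biUnion G.edgeSet.toFinite (A := D.arc)
    (D := fun e' => if e' = e then {θ, φ} else ∅) (fun e' he' => by
      split_ifs with hee
      · rw [hee]; exact h
      · refine conicAt_empty_of_notMem (D.isClosed_arc he') fun hx' => ?_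
        obtain ⟨v, -, -, hv⟩ := D.arc_inter_arc e' he' e he hee x ⟨hx', hx.1⟩
        exact hx.2 ⟨v, hv⟩))
  change ConicAt D.support x _ at h2
  convert h2 using 1
  ext ψ
  simp only [empty_union, mem_iUnion]
  constructor
  · intro hψ
    exact ⟨e, he, by rwa [if_pos rfl]⟩
  · rintro ⟨e', -, hψ⟩
    split_ifs at hψ
    · exact hψ
    · exact absurd hψ (notMem_empty _)

/-- The edges at a vertex leave it in different directions. -/
theorem conicAt_support_point (v : V) : ∃ θ : Sym2 V → Real.Angle,
    (∀ e ∈ G.incidenceSet v, ConicAt (D.arc e) (D.point v) {θ e}) ∧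
      InjOn θ (G.incidenceSet v) ∧ ConicAt D.support (D.point v) (θ '' G.incidenceSet v) := by
  classical
  have hex : ∀ e, ∃ θ, e ∈ G.incidenceSet v → ConicAt (D.arc e) (D.point v) {θ} := by
    intro e
    by_cases he : e ∈ G.incidenceSet v
    · obtain ⟨θ, hθ⟩ := D.conicAt_arc_point he.1 he.2
      exact ⟨θ, fun _ => hθ⟩
    · exact ⟨0, fun h => absurd h he⟩
  choose θ hθ using hex
  refine ⟨θ, hθ, ?_, ?_⟩
  · intro e he e' he' heq
    by_contra hne
    have := (hθ e he).disjoint (hθ e' he') (by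
      rintro x ⟨h1, h2⟩
      obtain ⟨w, hw, hw', rfl⟩ := D.arc_inter_arc e he.1 e' he'.1 hne x ⟨h1, h2⟩
      by_cases hwv : w = v
      · rw [hwv]; rfl
      · exact absurd (Sym2.eq_of_ne_mem hwv hw he.2 hw' he'.2) hne)
    rw [heq] at this
    simp at this
  · have h2 := (D.conicAt_range_point (D.point v)).union (ConicAt.biUnion G.edgeSet.toFinite
      (A := D.arc) (D := fun e => if v ∈ e then {θ e} else ∅) (fun e he => by
      split_ifs with hv
      · exact hθ e ⟨he, hv⟩
      · exact conicAt_empty_of_notMem (D.isClosed_arc he)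
          fun hx => hv (D.mem_of_point_mem_arc e he v hx)))
    change ConicAt D.support (D.point v) _ at h2
    convert h2 using 1
    ext ψ
    simp only [empty_union, mem_iUnion, mem_image]
    constructor
    · rintro ⟨e, he, rfl⟩
      exact ⟨e, he.1, by rw [if_pos he.2]; rfl⟩
    · rintro ⟨e, he, hψ⟩
      split_ifs at hψ with hv
      · exact ⟨e, ⟨he, hv⟩, hψ.symm⟩
      · exact absurd hψ (notMem_empty _)

/-- Close to an end of an edge, the ray in the direction of the edge runs inside the edge. -/
theorem exists_mem_openArc {e : Sym2 V} {v : V} {θ : Real.Angle}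
    (h : ConicAt (D.arc e) (D.point v) {θ}) :
    ∃ r > 0, ∀ t : ℝ, 0 < t → t < r → D.point v + t • unitVec θ ∈ D.openArc e := by
  obtain ⟨r, hr, h⟩ := h
  obtain ⟨r', hr', h'⟩ := D.conicAt_range_point (D.point v)
  refine ⟨min r r', lt_min hr hr', fun t ht ht' => ⟨?_, ?_⟩⟩
  · exact (h t ht (ht'.trans_le (min_le_left _ _)) θ).2 rfl
  · exact fun hm => (h' t ht (ht'.trans_le (min_le_right _ _)) θ).1 hm

theorem arc_subset_closure_openArc {e : Sym2 V} (he : e ∈ G.edgeSet) :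
    D.arc e ⊆ closure (D.openArc e) := by
  intro x hx
  by_cases hxp : x ∈ range D.point
  · obtain ⟨v, rfl⟩ := hxp
    obtain ⟨θ, hθ⟩ := D.conicAt_arc_point he (D.mem_of_point_mem_arc e he v hx)
    obtain ⟨r, hr, h⟩ := D.exists_mem_openArc hθ
    rw [mem_closure_iff_nhds]
    intro U hU
    obtain ⟨r', hr', h'⟩ := exists_forall_add_smul_unitVec_mem hU
    have h0 : 0 < min r r' / 2 := half_pos (lt_min hr hr')
    have hlt : min r r' / 2 < min r r' := half_lt_self (lt_min hr hr')
    exact ⟨_, h' _ h0.le (hlt.trans_le (min_le_right _ _)) θ,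
      h _ h0 (hlt.trans_le (min_le_left _ _))⟩
  · exact subset_closure ⟨hx, hxp⟩

theorem openArc_nonempty {e : Sym2 V} (he : e ∈ G.edgeSet) : (D.openArc e).Nonempty := by
  induction e using Sym2.ind with | h u v =>
  rw [← closure_nonempty_iff]
  exact ⟨_, D.arc_subset_closure_openArc he (D.point_mem_arc he (Sym2.mem_mk_left u v))⟩

variable {D} {F F' : Set (ℝ × ℝ)}

theorem mem_frontier_iff (hF : D.IsFace F) {x : ℝ × ℝ} (hx : x ∈ D.support) :
    x ∈ frontier F ↔ x ∈ closure F :=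
  IsComplComponent.mem_frontier_iff D.isClosed_support hF hx

/-- A face that touches an edge in an inner point touches all of it: in the open arc, the points in
the closure of the face form a set that is open and closed. -/
theorem subset_closure_of_mem_openArc (hF : D.IsFace F) {e : Sym2 V} (he : e ∈ G.edgeSet)
    {x : ℝ × ℝ} (hx : x ∈ D.openArc e) (hxF : x ∈ closure F) : D.openArc e ⊆ closure F := by
  have hpc : PreconnectedSpace (D.openArc e) :=
    isPreconnected_iff_preconnectedSpace.1 (D.isPreconnected_openArc he)
  set S : Set (D.openArc e) := {y | (y : ℝ × ℝ) ∈ closure F} with hS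
  have hclopen : IsClopen S := by
    refine ⟨isClosed_closure.preimage continuous_subtype_val, ?_⟩
    rw [isOpen_iff_mem_nhds]
    rintro ⟨y, hy⟩ hyF
    obtain ⟨θ, φ, hne, hc⟩ := D.conicAt_support_openArc he hy
    have hyK := D.arc_subset_support he hy.1
    obtain ⟨α, hα, β, hβ, hαβ, r, hr, h⟩ :=
      hc.exists_corner (toFinite _) hyK ⟨θ, Or.inl rfl⟩ hF hyF
    have hαβ := hαβ ⟨θ, Or.inl rfl, φ, Or.inr rfl, hne⟩
    obtain ⟨r', hr', hK⟩ := hc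
    rw [nhds_subtype_eq_comap]
    refine ⟨_, polar_mem_nhds y (lt_min hr hr'), ?_⟩
    rintro ⟨z, hz⟩ ⟨t, ψ, ht, ht', hzt⟩
    show z ∈ closure F
    change z = _ at hzt
    subst hzt
    rcases ht.eq_or_lt with rfl | ht
    · simpa using (show y ∈ closure F from hyF)
    have hψ := (hK t ht (ht'.trans_le (min_le_right _ _)) ψ).1 (D.arc_subset_support he hz.1)
    have h := h t ht (ht'.trans_le (min_le_left _ _))
    have : ψ = α ∨ ψ = β := by
      simp only [mem_insert_iff, mem_singleton_iff] at hα hβ hψ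
      rcases hα with rfl | rfl <;> rcases hβ with rfl | rfl <;> tauto
    rcases this with rfl | rfl
    · exact h.1
    · exact h.2
  rcases isClopen_iff.1 hclopen with h | h
  · exact absurd (show (⟨x, hx⟩ : D.openArc e) ∈ S from hxF) (h ▸ notMem_empty _)
  · intro y hy
    exact (h ▸ mem_univ _ : (⟨y, hy⟩ : D.openArc e) ∈ S)

theorem mem_boundaryEdges_of_mem_openArc (hF : D.IsFace F) {e : Sym2 V} (he : e ∈ G.edgeSet)
    {x : ℝ × ℝ} (hx : x ∈ D.openArc e) (hxF : x ∈ closure F) : e ∈ D.boundaryEdges F := by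
  refine ⟨he, fun y hy => ?_⟩
  rw [mem_frontier_iff hF (D.arc_subset_support he hy)]
  exact closure_minimal (subset_closure_of_mem_openArc hF he hx hxF) isClosed_closure
    (D.arc_subset_closure_openArc he hy)

/-- An edge is on the boundary of at most two faces. -/
theorem face_eq_or_of_mem_boundaryEdges {e : Sym2 V} {F : Fin 3 → Set (ℝ × ℝ)}
    (hF : ∀ i, D.IsFace (F i)) (he : ∀ i, e ∈ D.boundaryEdges (F i)) :
    ∃ i j, i ≠ j ∧ F i = F j := by
  obtain ⟨x, hx⟩ := D.openArc_nonempty (he 0).1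
  obtain ⟨θ, φ, hne, hc⟩ := D.conicAt_support_openArc (he 0).1 hx
  exact hc.component_eq_or hne (D.arc_subset_support (he 0).1 hx.1) hF
    fun i => frontier_subset_closure ((he i).2 hx.1)

/-- A face at a vertex that is not isolated has on its boundary two edges at this vertex, or the
only edge at this vertex, which then bounds no other face. -/
theorem exists_boundaryEdges_of_point_mem (hF : D.IsFace F) {v : V}
    (hv : D.point v ∈ closure F) (hne : (G.incidenceSet v).Nonempty) :
    (∃ e ∈ G.incidenceSet v, ∃ e' ∈ G.incidenceSet v, e ≠ e' ∧ e ∈ D.boundaryEdges F ∧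
      e' ∈ D.boundaryEdges F) ∨
    ∃ e, G.incidenceSet v = {e} ∧ e ∈ D.boundaryEdges F ∧
      ∀ F', D.IsFace F' → e ∈ D.boundaryEdges F' → F' = F := by
  obtain ⟨θ, hθ, hinj, hc⟩ := D.conicAt_support_point v
  obtain ⟨_, ⟨e, he, rfl⟩, _, ⟨e', he', rfl⟩, hee, r, hr, h⟩ :=
    hc.exists_corner (toFinite _) (D.point_mem_support v) (hne.image θ) hF hv
  have key : ∀ e ∈ G.incidenceSet v, (∀ t : ℝ, 0 < t → t < r →
      D.point v + t • unitVec (θ e) ∈ closure F) → e ∈ D.boundaryEdges F := by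
    intro e he h
    obtain ⟨r', hr', h'⟩ := D.exists_mem_openArc (hθ e he)
    have h0 : 0 < min r r' / 2 := half_pos (lt_min hr hr')
    have hlt : min r r' / 2 < min r r' := half_lt_self (lt_min hr hr')
    exact mem_boundaryEdges_of_mem_openArc hF he.1
      (h' _ h0 (hlt.trans_le (min_le_right _ _))) (h _ h0 (hlt.trans_le (min_le_left _ _)))
  have heF := key e he fun t ht ht' => (h t ht ht').1
  have heF' := key e' he' fun t ht ht' => (h t ht ht').2
  by_cases hnt : (G.incidenceSet v).Nontrivial
  · exact Or.inl ⟨e, he, e', he', fun h => hee (hnt.image_of_injOn hinj) (by rw [h]), heF, heF'⟩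
  · right
    rw [not_nontrivial_iff] at hnt
    refine ⟨e, hnt.eq_singleton_of_mem he, heF, fun F' hF' heF'' => ?_⟩
    exact hc.component_unique (D.point_mem_support v) (hnt.image θ) hF'
      (frontier_subset_closure (heF''.2 (D.point_mem_arc he.1 he.2))) hF hv

/-- A face that is on both sides of all edges on its boundary, at vertices where no two edges meet,
is the only face: its closure is open. -/
theorem face_unique (hF : D.IsFace F)
    (hedge : ∀ e ∈ D.boundaryEdges F, ∀ F', D.IsFace F' → e ∈ D.boundaryEdges F' → F' = F)
    (hvert : ∀ v, D.point v ∈ closure F → (G.incidenceSet v).Subsingleton)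
    (hF' : D.IsFace F') : F' = F := by
  have hopen : IsOpen (closure F) := by
    rw [isOpen_iff_mem_nhds]
    intro x hx
    by_cases hxF : x ∈ F
    · exact mem_of_superset ((IsComplComponent.isOpen D.isClosed_support hF).mem_nhds hxF)
        subset_closure
    have hxK : x ∈ D.support := IsComplComponent.frontier_subset D.isClosed_support hF
      ⟨hx, fun h => hxF (interior_subset h)⟩
    by_cases hxv : x ∈ range D.point
    · obtain ⟨v, rfl⟩ := hxv
      obtain ⟨θ, -, -, hc⟩ := D.conicAt_support_point v
      refine hc.closure_mem_nhds (toFinite _) hx fun F' hF' hxF' => ?_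
      exact hc.component_unique hxK ((hvert v hx).image θ) hF' hxF' hF hx
    · obtain ⟨e, he, hxe⟩ := mem_iUnion₂.1 (hxK.resolve_left hxv)
      obtain ⟨θ, φ, -, hc⟩ := D.conicAt_support_openArc he ⟨hxe, hxv⟩
      refine hc.closure_mem_nhds (toFinite _) hx fun F' hF' hxF' => ?_
      exact hedge e (mem_boundaryEdges_of_mem_openArc hF he ⟨hxe, hxv⟩ hx) F' hF'
        (mem_boundaryEdges_of_mem_openArc hF' he ⟨hxe, hxv⟩ hxF')
  have huniv : closure F = univ :=
    IsClopen.eq_univ ⟨isClosed_closure, hopen⟩ (IsComplComponent.nonempty hF).closure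
  obtain ⟨y, hy⟩ := IsComplComponent.nonempty hF'
  exact (IsComplComponent.eq_of_mem_closure D.isClosed_support hF hF' hy
    (huniv ▸ mem_univ y)).symm

end PlaneDrawing

/-! ### Euler's formula by logarithmic potentials -/

/-- The point of the complex plane with the given coordinates. -/
noncomputable abbrev toComplex : (ℝ × ℝ) ≃L[ℝ] ℂ := Complex.equivRealProdCLM.symm

theorem toComplex_re (x : ℝ × ℝ) : (toComplex x).re = x.1 := rfl

theorem toComplex_im (x : ℝ × ℝ) : (toComplex x).im = x.2 := rfl

/-- The logarithms of the quotients `(b - z) / (a - z)`, summed over the segments `[a, b]` of a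
polygonal line. The imaginary part is the angle under which the line is seen from `z`. -/
noncomputable def logPotential : List (ℝ × ℝ) → ℂ → ℂ
  | a :: b :: l, z =>
      Complex.log ((toComplex b - z) / (toComplex a - z)) + logPotential (b :: l) z
  | _, _ => 0

theorem div_mem_slitPlane {a b x : ℝ × ℝ} (hx : x ∉ segment ℝ a b) :
    (toComplex b - toComplex x) / (toComplex a - toComplex x) ∈ Complex.slitPlane := by
  rw [Complex.mem_slitPlane_iff_not_le_zero]
  intro hle
  apply hx
  have hxa : toComplex a - toComplex x ≠ 0 := by
    rw [sub_ne_zero]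
    intro h
    exact hx (toComplex.injective h ▸ left_mem_segment ℝ a b)
  set w := (toComplex b - toComplex x) / (toComplex a - toComplex x) with hw
  obtain ⟨hre, him⟩ := Complex.le_def.1 hle
  have hre : w.re ≤ 0 := hre
  have him : w.im = 0 := him
  have hwr : w = (w.re : ℂ) := Complex.ext rfl (by simp [him])
  have h : toComplex b - toComplex x = (w.re : ℂ) * (toComplex a - toComplex x) := by
    rw [← hwr, hw, div_mul_cancel₀ _ hxa]
  have h1 := congrArg Complex.re h
  have h2 := congrArg Complex.im h
  rw [Complex.re_ofReal_mul] at h1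
  rw [Complex.im_ofReal_mul] at h2
  simp only [Complex.sub_re, Complex.sub_im, toComplex_re, toComplex_im] at h1 h2
  have h0 : 0 < 1 - w.re := by linarith
  refine ⟨-w.re / (1 - w.re), 1 / (1 - w.re), div_nonneg (by linarith) h0.le, by positivity,
    by field_simp; ring, ?_⟩
  ext
  · simp only [Prod.fst_add, Prod.smul_fst, smul_eq_mul]
    field_simp
    linarith
  · simp only [Prod.snd_add, Prod.smul_snd, smul_eq_mul]
    field_simp
    linarith

theorem hasDerivAt_log_div {a b x : ℝ × ℝ} (hx : x ∉ segment ℝ a b) :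
    HasDerivAt (fun z => Complex.log ((toComplex b - z) / (toComplex a - z)))
      ((toComplex a - toComplex x)⁻¹ - (toComplex b - toComplex x)⁻¹) (toComplex x) := by
  have hxa : toComplex a - toComplex x ≠ 0 := by
    rw [sub_ne_zero]
    intro h
    exact hx (toComplex.injective h ▸ left_mem_segment ℝ a b)
  have hxb : toComplex b - toComplex x ≠ 0 := by
    rw [sub_ne_zero]
    intro h
    exact hx (toComplex.injective h ▸ right_mem_segment ℝ a b)
  have h := (((hasDerivAt_id (toComplex x)).const_sub (toComplex b)).div
    ((hasDerivAt_id (toComplex x)).const_sub (toComplex a)) hxa).clog (div_mem_slitPlane hx)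
  refine h.congr_deriv ?_
  simp only [id, Pi.div_apply]
  field_simp
  ring

/-- The derivative of the potential of a polygonal line depends only on its ends. -/
theorem hasDerivAt_logPotential {a q x : ℝ × ℝ} {l : List (ℝ × ℝ)}
    (hq : (a :: l).getLast? = some q) (hx : x ∉ polyline (a :: l)) :
    HasDerivAt (logPotential (a :: l))
      ((toComplex a - toComplex x)⁻¹ - (toComplex q - toComplex x)⁻¹) (toComplex x) := by
  induction l generalizing a with
  | nil =>
    obtain rfl : a = q := by simpa using hq
    rw [sub_self]
    exact hasDerivAt_const _ (0 : ℂ)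
  | cons b l ih =>
    have h1 := hasDerivAt_log_div fun h => hx (Or.inl h)
    have h2 := ih (by simpa using hq) fun h => hx (Or.inr h)
    refine (h1.add h2).congr_deriv ?_
    ring

/-- The logarithm of `(b - z) / (a - z)` jumps by `2πi` across the midpoint of `[a, b]`. -/
theorem tendsto_log_div_sub {a b : ℂ} (hab : a ≠ b) :
    Tendsto (fun ε : ℝ =>
      Complex.log ((b - ((a + b) / 2 + ε * (Complex.I * (b - a)))) /
          (a - ((a + b) / 2 + ε * (Complex.I * (b - a))))) -
        Complex.log ((b - ((a + b) / 2 + (-ε : ℝ) * (Complex.I * (b - a)))) /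
          (a - ((a + b) / 2 + (-ε : ℝ) * (Complex.I * (b - a)))))) (𝓝[>] 0)
      (𝓝 (2 * Real.pi * Complex.I)) := by
  set A : ℝ → ℂ := fun ε => ⟨(ε ^ 2 - 1 / 4) / (1 / 4 + ε ^ 2), ε / (1 / 4 + ε ^ 2)⟩ with hA
  have hpos : ∀ ε : ℝ, 0 < 1 / 4 + ε ^ 2 := fun ε => by positivity
  have hAeq : ∀ ε : ℝ, (b - ((a + b) / 2 + ε * (Complex.I * (b - a)))) /
      (a - ((a + b) / 2 + ε * (Complex.I * (b - a)))) = A ε := by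
    intro ε
    have hba : b - a ≠ 0 := sub_ne_zero.2 hab.symm
    have hd : (-(1 / 2) - ε * Complex.I : ℂ) ≠ 0 := by
      intro h
      have := congrArg Complex.re h
      norm_num at this
    have e1 : b - ((a + b) / 2 + ε * (Complex.I * (b - a))) =
        (b - a) * (1 / 2 - ε * Complex.I) := by ring
    have e2 : a - ((a + b) / 2 + ε * (Complex.I * (b - a))) =
        (b - a) * (-(1 / 2) - ε * Complex.I) := by ring
    rw [e1, e2, mul_div_mul_left _ _ hba, div_eq_iff hd]
    have := (hpos ε).ne'
    apply Complex.ext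
    · simp [hA]
      field_simp
      ring
    · simp [hA]
      field_simp
      ring
  simp only [hAeq]
  have hAc : Continuous A := by
    have h : A = fun ε : ℝ => (((ε ^ 2 - 1 / 4) / (1 / 4 + ε ^ 2) : ℝ) : ℂ) +
        ((ε / (1 / 4 + ε ^ 2) : ℝ) : ℂ) * Complex.I := by
      funext ε
      rw [← Complex.mk_eq_add_mul_I]
    rw [h]
    have h1 : Continuous fun ε : ℝ => (ε ^ 2 - 1 / 4) / (1 / 4 + ε ^ 2) :=
      Continuous.div (by fun_prop) (by fun_prop) fun ε => (hpos ε).ne'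
    have h2 : Continuous fun ε : ℝ => ε / (1 / 4 + ε ^ 2) :=
      Continuous.div (by fun_prop) (by fun_prop) fun ε => (hpos ε).ne'
    fun_prop
  have hA0 : A 0 = -1 := by
    apply Complex.ext <;> norm_num [hA]
  have hup : Tendsto (fun ε => Complex.log (A ε)) (𝓝[>] 0) (𝓝 (Real.pi * Complex.I)) := by
    have h := Complex.continuousWithinAt_log_of_re_neg_of_im_zero (z := -1) (by simp) (by simp)
    have h' := h.tendsto
    rw [Complex.log_neg_one] at h'
    refine h'.comp (tendsto_nhdsWithin_iff.2 ⟨?_, ?_⟩)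
    · rw [← hA0]
      exact hAc.continuousAt.tendsto.mono_left nhdsWithin_le_nhds
    · filter_upwards [self_mem_nhdsWithin] with ε hε
      exact div_nonneg (le_of_lt hε) (hpos ε).le
  have hdown : Tendsto (fun ε => Complex.log (A (-ε))) (𝓝[>] 0) (𝓝 (-(Real.pi * Complex.I))) := by
    have h := Complex.tendsto_log_nhdsWithin_im_neg_of_re_neg_of_im_zero (z := -1) (by simp)
      (by simp)
    have h0 : (Real.log ‖(-1 : ℂ)‖ - Real.pi * Complex.I : ℂ) = -(Real.pi * Complex.I) := by simp
    rw [h0] at h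
    refine h.comp (tendsto_nhdsWithin_iff.2 ⟨?_, ?_⟩)
    · rw [← hA0]
      have hc : Continuous fun ε : ℝ => A (-ε) := hAc.comp continuous_neg
      have := hc.continuousAt.tendsto (x := 0)
      rw [neg_zero] at this
      exact this.mono_left nhdsWithin_le_nhds
    · filter_upwards [self_mem_nhdsWithin] with ε hε
      exact div_neg_of_neg_of_pos (neg_neg_of_pos hε) (hpos _)
  convert hup.sub hdown using 2
  ring

namespace PlaneDrawing

variable {V : Type*} [Finite V] {G : SimpleGraph V} (D : PlaneDrawing G)

/-- If a combination of the potentials of the edges takes the same value at all points off the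
drawing, then it is the trivial combination. -/
theorem coeff_eq_zero_of_const [Fintype G.edgeSet] {a b : G.edgeSet → ℝ × ℝ}
    {l : G.edgeSet → List (ℝ × ℝ)} {q : G.edgeSet → ℝ × ℝ}
    (hs : ∀ e, IsSimplePolyline (a e :: b e :: l e))
    (hlast : ∀ e, (b e :: l e).getLast? = some (q e))
    (harc : ∀ e : G.edgeSet, polyline (a e :: b e :: l e) = D.arc e)
    (hends : ∀ e : G.edgeSet, ∀ v, D.point v ∈ D.arc e → D.point v = a e ∨ D.point v = q e)
    {z : G.edgeSet → ℂ} {c : ℂ}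
    (hconst : ∀ x ∉ D.support,
      ∑ e, z e * logPotential (a e :: b e :: l e) (toComplex x) = c) : z = 0 := by
  classical
  funext e₀
  set x : ℝ × ℝ := (1 / 2 : ℝ) • (a e₀ + b e₀) with hx
  have hne := (hs e₀).1
  have hxseg : x ∈ segment ℝ (a e₀) (b e₀) :=
    ⟨1 / 2, 1 / 2, by norm_num, by norm_num, by norm_num, by rw [hx, smul_add]⟩
  have hxa : x ≠ a e₀ := by
    intro h
    apply hne
    have h1 := congrArg Prod.fst h
    have h2 := congrArg Prod.snd h
    simp [hx] at h1 h2
    ext <;> linarith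
  have hxb : x ≠ b e₀ := by
    intro h
    apply hne
    have h1 := congrArg Prod.fst h
    have h2 := congrArg Prod.snd h
    simp [hx] at h1 h2
    ext <;> linarith
  have hxpoly : x ∉ polyline (b e₀ :: l e₀) := by
    intro h
    have : x ∈ segment ℝ (a e₀) (b e₀) ∩ polyline (b e₀ :: l e₀) := ⟨hxseg, h⟩
    rw [(hs e₀).2.1] at this
    exact hxb this
  have hxarc : x ∈ D.arc e₀ := harc e₀ ▸ Or.inl hxseg
  have hxrange : x ∉ range D.point := by
    rintro ⟨v, hv⟩
    rcases hends e₀ v (hv ▸ hxarc) with h | h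
    · exact hxa (hv ▸ h)
    · exact hxpoly (by rw [← hv, h]; exact last_mem_polyline (hlast e₀))
  have hxother : ∀ e, e ≠ e₀ → x ∉ D.arc e := by
    intro e he hxe
    obtain ⟨v, -, -, hv⟩ := D.arc_inter_arc e e.2 e₀ e₀.2 (fun h => he (Subtype.ext h)) x
      ⟨hxe, hxarc⟩
    exact hxrange ⟨v, hv⟩
  -- the part of the combination that is continuous at `x`: all but the segment through `x`
  set g : ℂ → ℂ := fun w => (∑ e ∈ Finset.univ.erase e₀,
    z e * logPotential (a e :: b e :: l e) w) + z e₀ * logPotential (b e₀ :: l e₀) w with hg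
  have hgc : ContinuousAt g (toComplex x) := by
    refine ContinuousAt.add ?_ ?_
    · refine tendsto_finsetSum _ fun e he => ?_
      exact (continuousAt_const.mul (hasDerivAt_logPotential (a := a e) (q := q e)
        (by simpa using hlast e)
        (fun h => hxother e (Finset.ne_of_mem_erase he) (harc e ▸ h))).continuousAt).tendsto
    · exact continuousAt_const.mul (hasDerivAt_logPotential (hlast e₀) hxpoly).continuousAt
  -- the points at distance proportional to `ε` from `x` on the perpendicular bisector
  set P : ℝ → ℝ × ℝ := fun ε => x + ε • (-((b e₀).2 - (a e₀).2), (b e₀).1 - (a e₀).1) with hP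
  have hPc : ∀ ε : ℝ, toComplex (P ε) = (toComplex (a e₀) + toComplex (b e₀)) / 2 +
      ε * (Complex.I * (toComplex (b e₀) - toComplex (a e₀))) := by
    intro ε
    apply Complex.ext
    · have h2 : ((toComplex (a e₀) + toComplex (b e₀)) / 2).re = ((a e₀).1 + (b e₀).1) / 2 := by
        rw [show (2 : ℂ) = ((2 : ℝ) : ℂ) by norm_num, Complex.div_ofReal_re]; rfl
      rw [Complex.add_re, h2, Complex.re_ofReal_mul]
      simp only [Complex.mul_re, Complex.I_re, Complex.I_im, Complex.sub_re, Complex.sub_im,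
        toComplex_re, toComplex_im, hP, hx]
      simp
      ring
    · have h2 : ((toComplex (a e₀) + toComplex (b e₀)) / 2).im = ((a e₀).2 + (b e₀).2) / 2 := by
        rw [show (2 : ℂ) = ((2 : ℝ) : ℂ) by norm_num, Complex.div_ofReal_im]; rfl
      rw [Complex.add_im, h2, Complex.im_ofReal_mul]
      simp only [Complex.mul_im, Complex.I_re, Complex.I_im, Complex.sub_re, Complex.sub_im,
        toComplex_re, toComplex_im, hP, hx]
      simp
      ring
  have hPcont : Continuous P := by rw [hP]; fun_prop
  have hP0 : P 0 = x := by simp [hP]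
  have hPseg : ∀ ε : ℝ, ε ≠ 0 → P ε ∉ segment ℝ (a e₀) (b e₀) := by
    intro ε hε hm
    rw [segment_eq_image'] at hm
    obtain ⟨k, -, hk⟩ := hm
    have h1 := congrArg Prod.fst hk
    have h2 := congrArg Prod.snd hk
    simp [hP, hx] at h1 h2
    have h3 : ε * (((b e₀).1 - (a e₀).1) ^ 2 + ((b e₀).2 - (a e₀).2) ^ 2) = 0 := by
      linear_combination (-((b e₀).1 - (a e₀).1)) * h2 + ((b e₀).2 - (a e₀).2) * h1
    have h4 := (mul_eq_zero.1 h3).resolve_left hε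
    apply hne
    ext
    · nlinarith [sq_nonneg ((b e₀).1 - (a e₀).1), sq_nonneg ((b e₀).2 - (a e₀).2)]
    · nlinarith [sq_nonneg ((b e₀).1 - (a e₀).1), sq_nonneg ((b e₀).2 - (a e₀).2)]
  -- the rest of the drawing, which keeps away from `x`
  set R : Set (ℝ × ℝ) := range D.point ∪ (⋃ e ∈ {e : G.edgeSet | e ≠ e₀}, D.arc e) ∪
    polyline (b e₀ :: l e₀) with hR
  have hRclosed : IsClosed R := ((finite_range D.point).isClosed.union
    ((toFinite _).isClosed_biUnion fun e _ => D.isClosed_arc e.2)).union (isClosed_polyline _)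
  have hxR : x ∉ R := by
    rintro ((h | h) | h)
    · exact hxrange h
    · obtain ⟨e, he, hxe⟩ := mem_iUnion₂.1 h
      exact hxother e he hxe
    · exact hxpoly h
  have hsupp : D.support ⊆ R ∪ segment ℝ (a e₀) (b e₀) := by
    rintro y (hy | hy)
    · exact Or.inl (Or.inl (Or.inl hy))
    · obtain ⟨e, he, hye⟩ := mem_iUnion₂.1 hy
      by_cases hee : (⟨e, he⟩ : G.edgeSet) = e₀
      · have hye : y ∈ D.arc e₀ := hee ▸ hye
        rw [← harc e₀] at hye
        rcases hye with h | h
        · exact Or.inr h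
        · exact Or.inl (Or.inr h)
      · exact Or.inl (Or.inl (Or.inr (mem_iUnion₂.2 ⟨⟨e, he⟩, hee, hye⟩)))
  have hsplit : ∀ w, ∑ e, z e * logPotential (a e :: b e :: l e) w =
      z e₀ * Complex.log ((toComplex (b e₀) - w) / (toComplex (a e₀) - w)) + g w := by
    intro w
    rw [← Finset.add_sum_erase _ _ (Finset.mem_univ e₀)]
    simp only [hg, logPotential]
    ring
  have hev : ∀ᶠ ε : ℝ in 𝓝[>] 0, P ε ∉ D.support ∧ P (-ε) ∉ D.support := by
    have h1 : ∀ᶠ ε : ℝ in 𝓝 0, P ε ∈ Rᶜ := by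
      have := hPcont.continuousAt.tendsto (x := 0)
      rw [hP0] at this
      exact this (hRclosed.isOpen_compl.mem_nhds hxR)
    have h2 : ∀ᶠ ε : ℝ in 𝓝 0, P (-ε) ∈ Rᶜ := by
      have := (hPcont.comp continuous_neg).continuousAt.tendsto (x := (0 : ℝ))
      rw [Function.comp, neg_zero, hP0] at this
      exact this (hRclosed.isOpen_compl.mem_nhds hxR)
    filter_upwards [nhdsWithin_le_nhds h1, nhdsWithin_le_nhds h2, self_mem_nhdsWithin]
      with ε h1 h2 hε
    exact ⟨fun h => (hsupp h).elim h1 (hPseg ε (ne_of_gt hε)),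
      fun h => (hsupp h).elim h2 (hPseg (-ε) (neg_ne_zero.2 (ne_of_gt hε)))⟩
  have hjump := tendsto_log_div_sub (toComplex.injective.ne hne)
  simp only [← hPc] at hjump
  have hgl : Tendsto (fun ε : ℝ => g (toComplex (P ε)) - g (toComplex (P (-ε)))) (𝓝[>] 0)
      (𝓝 0) := by
    have hc1 : Tendsto (fun ε : ℝ => toComplex (P ε)) (𝓝 0) (𝓝 (toComplex x)) := by
      have := (toComplex.continuous.comp hPcont).continuousAt.tendsto (x := (0 : ℝ))
      rwa [Function.comp, hP0] at this
    have hc2 : Tendsto (fun ε : ℝ => toComplex (P (-ε))) (𝓝 0) (𝓝 (toComplex x)) := by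
      have := (toComplex.continuous.comp (hPcont.comp continuous_neg)).continuousAt.tendsto
        (x := (0 : ℝ))
      rwa [Function.comp, Function.comp, neg_zero, hP0] at this
    have := (hgc.tendsto.comp hc1).sub (hgc.tendsto.comp hc2)
    rw [sub_self] at this
    exact this.mono_left nhdsWithin_le_nhds
  have hlim := (hjump.const_mul (z e₀)).add hgl
  have hzero : Tendsto (fun _ : ℝ => (0 : ℂ)) (𝓝[>] 0)
      (𝓝 (z e₀ * (2 * Real.pi * Complex.I) + 0)) := by
    refine hlim.congr' ?_
    filter_upwards [hev] with ε hε
    have h1 := hconst _ hε.1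
    have h2 := hconst _ hε.2
    rw [hsplit] at h1 h2
    linear_combination h1 - h2
  have := tendsto_nhds_unique hzero tendsto_const_nhds
  simpa [Real.pi_ne_zero] using this

/-- The inequality of Euler's formula that bounds the number of faces from below, with isolated
vertices left out. For a flow `z` on the edges with boundary `0`, the sum of the potentials of the
edges with coefficients `z` is constant on each face. A flow for which all these constants agree is
`0`, so that the flows and the constants together inject into the functions on the faces. -/
theorem ncard_edgeSet_add_two_le (hfin : {F | D.IsFace F}.Finite) (hE : G.edgeSet.Nonempty) :
    G.edgeSet.ncard + 2 ≤ {F | D.IsFace F}.ncard + {v | (G.incidenceSet v).Nonempty}.ncard := by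
  classical
  have : Fintype V := Fintype.ofFinite V
  have : Fintype G.edgeSet := Fintype.ofFinite _
  have : Fintype {F | D.IsFace F} := hfin.fintype
  choose u v a b l hedge _ hs ha hlast harc using fun e : G.edgeSet => D.exists_polyline e.2
  obtain ⟨e₁⟩ : Nonempty G.edgeSet := hE.to_subtype
  set v₀ := u e₁ with hv₀
  have hinc : ∀ e : G.edgeSet, (G.incidenceSet (u e)).Nonempty ∧
      (G.incidenceSet (v e)).Nonempty := fun e =>
    ⟨⟨e, e.2, by rw [hedge e]; exact Sym2.mem_mk_left _ _⟩,
      ⟨e, e.2, by rw [hedge e]; exact Sym2.mem_mk_right _ _⟩⟩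
  set N : Set V := {v | (G.incidenceSet v).Nonempty} with hN
  have : Fintype ↥(N \ {v₀}) := Fintype.ofFinite _
  -- the boundary map from flows on the edges to the vertices
  set bd : (G.edgeSet → ℂ) →ₗ[ℂ] (V → ℂ) :=
    { toFun := fun z w => ∑ e, z e * ((if u e = w then 1 else 0) - (if v e = w then 1 else 0))
      map_add' := fun y z => by
        funext w
        simp [add_mul, Finset.sum_add_distrib]
      map_smul' := fun k z => by
        funext w
        simp [Finset.mul_sum, mul_assoc] } with hbd
  have hsum : ∀ z (g : V → ℂ), ∑ w, bd z w * g w = ∑ e, z e * (g (u e) - g (v e)) := by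
    intro z g
    simp only [hbd, LinearMap.coe_mk, AddHom.coe_mk, Finset.sum_mul]
    rw [Finset.sum_comm]
    refine Finset.sum_congr rfl fun e _ => ?_
    simp only [mul_assoc, ← Finset.mul_sum, sub_mul, Finset.sum_sub_distrib, ite_mul, one_mul,
      zero_mul, Finset.sum_ite_eq, Finset.mem_univ, if_true]
  -- leaving out the isolated vertices and `v₀` loses nothing, since all boundaries have sum `0`
  set bd' : (G.edgeSet → ℂ) →ₗ[ℂ] (↥(N \ {v₀}) → ℂ) :=
    (LinearMap.funLeft ℂ ℂ Subtype.val).comp bd with hbd'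
  have hker : ∀ z ∈ LinearMap.ker bd', bd z = 0 := by
    intro z hz
    have h1 : ∀ w ∈ N, w ≠ v₀ → bd z w = 0 := fun w hw hw0 =>
      congrFun (LinearMap.mem_ker.1 hz) ⟨w, hw, hw0⟩
    have h2 : ∀ w ∉ N, bd z w = 0 := by
      intro w hw
      refine Finset.sum_eq_zero fun e _ => ?_
      rw [if_neg, if_neg, sub_self, mul_zero]
      · rintro rfl; exact hw (hinc e).2
      · rintro rfl; exact hw (hinc e).1
    have h3 : ∀ w, w ≠ v₀ → bd z w = 0 := fun w hw =>
      if hwN : w ∈ N then h1 w hwN hw else h2 w hwN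
    funext w
    by_cases hw : w = v₀
    · have := hsum z (fun _ => 1)
      simp only [mul_one, sub_self, mul_zero, Finset.sum_const_zero] at this
      rw [Finset.sum_eq_single v₀ (fun w _ hw => h3 w hw) (by simp)] at this
      rw [hw, this]; rfl
    · exact h3 w hw
  set Φ : (G.edgeSet → ℂ) → ℂ → ℂ := fun z p =>
    ∑ e, z e * logPotential (a e :: b e :: l e) p with hΦ
  have hlast' : ∀ e, (a e :: b e :: l e).getLast? = some (D.point (v e)) := fun e => by
    simpa using hlast e
  have hderiv : ∀ z ∈ LinearMap.ker bd', ∀ x ∉ D.support,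
      HasDerivAt (Φ z) 0 (toComplex x) := by
    intro z hz x hx
    have h := HasDerivAt.fun_sum (u := Finset.univ) fun e _ => (hasDerivAt_logPotential (hlast' e)
      (fun h => hx (D.arc_subset_support e.2 (harc e ▸ h)))).const_mul (z e)
    refine h.congr_deriv ?_
    simp only [ha]
    have := hsum z (fun w => (toComplex (D.point w) - toComplex x)⁻¹)
    rw [← this, hker z hz]
    simp
  choose rep hrep hrepF using fun F : {F | D.IsFace F} => F.2
  have hconst : ∀ z ∈ LinearMap.ker bd', ∀ F : {F | D.IsFace F}, ∀ x ∈ F.1,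
      Φ z (toComplex x) = Φ z (toComplex (rep F)) := by
    intro z hz F x hxF
    have hopen : IsOpen (toComplex '' F.1) :=
      toComplex.toHomeomorph.isOpenMap _ (IsComplComponent.isOpen D.isClosed_support F.2)
    have hpre : IsPreconnected (toComplex '' F.1) :=
      (IsComplComponent.isPreconnected F.2).image _ toComplex.continuous.continuousOn
    have hd : ∀ p ∈ toComplex '' F.1, HasDerivAt (Φ z) 0 p := by
      rintro _ ⟨y, hy, rfl⟩
      exact hderiv z hz y (IsComplComponent.subset_compl F.2 hy)
    refine hopen.is_const_of_deriv_eq_zero hpre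
      (fun p hp => (hd p hp).differentiableAt.differentiableWithinAt)
      (fun p hp => (hd p hp).deriv) (mem_image_of_mem _ hxF) (mem_image_of_mem _ ?_)
    rw [hrepF F]
    exact mem_connectedComponentIn (hrep F)
  set Ψ : (LinearMap.ker bd' × ℂ) →ₗ[ℂ] ({F | D.IsFace F} → ℂ) :=
    { toFun := fun y F => Φ y.1 (toComplex (rep F)) - y.2
      map_add' := fun y z => by
        funext F
        simp [hΦ, add_mul, Finset.sum_add_distrib]
        ring
      map_smul' := fun k z => by
        funext F
        simp [hΦ, Finset.mul_sum, mul_assoc, mul_sub] } with hΨ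
  have hinj : Function.Injective Ψ := by
    rw [← LinearMap.ker_eq_bot, LinearMap.ker_eq_bot']
    rintro ⟨⟨z, hz⟩, c⟩ h
    have hall : ∀ F : {F | D.IsFace F}, Φ z (toComplex (rep F)) = c := fun F =>
      sub_eq_zero.1 (congrFun h F)
    have hends : ∀ e : G.edgeSet, ∀ w, D.point w ∈ D.arc e →
        D.point w = a e ∨ D.point w = D.point (v e) := by
      intro e w hw
      have := D.mem_of_point_mem_arc e e.2 w hw
      rw [hedge e] at this
      rcases Sym2.mem_iff.1 this with rfl | rfl
      · exact Or.inl (ha e).symm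
      · exact Or.inr rfl
    have hcoeff := fun (z : G.edgeSet → ℂ) (c : ℂ) => D.coeff_eq_zero_of_const (z := z) (c := c) hs
      hlast harc hends
    have hz0 : z = 0 := hcoeff z c fun x hx => by
      have hF : D.IsFace (connectedComponentIn D.supportᶜ x) := ⟨x, hx, rfl⟩
      rw [← hall ⟨_, hF⟩]
      exact hconst z hz ⟨_, hF⟩ x (mem_connectedComponentIn hx)
    subst hz0
    obtain ⟨x, hx⟩ : ∃ x, x ∉ D.support := by
      by_contra! hcon
      exact one_ne_zero (congrFun (hcoeff 1 0 fun x hx => absurd (hcon x) hx) e₁)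
    have hF : D.IsFace (connectedComponentIn D.supportᶜ x) := ⟨x, hx, rfl⟩
    have hc : c = 0 := by
      rw [← hall ⟨_, hF⟩]
      simp [hΦ]
    simp [hc]
  have hdim := LinearMap.finrank_le_finrank_of_injective hinj
  rw [Module.finrank_prod, Module.finrank_self, Module.finrank_fintype_fun_eq_card] at hdim
  have hrn := LinearMap.finrank_range_add_finrank_ker bd'
  have hrange := Submodule.finrank_le (LinearMap.range bd')
  rw [Module.finrank_fintype_fun_eq_card] at hrn hrange
  have hcardN : Fintype.card ↥(N \ {v₀}) + 1 = N.ncard := by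
    rw [← Set.ncard_sdiff_singleton_add_one (show v₀ ∈ N from (hinc e₁).1) (toFinite N),
      ← Nat.card_coe_set_eq, Nat.card_eq_fintype_card]
  have hcardE : Fintype.card G.edgeSet = G.edgeSet.ncard := by
    rw [← Nat.card_coe_set_eq, Nat.card_eq_fintype_card]
  have hcardF : Fintype.card {F | D.IsFace F} = {F | D.IsFace F}.ncard := by
    rw [← Nat.card_coe_set_eq, Nat.card_eq_fintype_card]
  omega

end PlaneDrawing

/-! ### Counting the sides of edges -/

namespace PlaneDrawing

variable {V : Type*} {G : SimpleGraph V} (D : PlaneDrawing G)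

/-- The number of sides of the edge `e` on which the face `F` lies. As in `faceLength`, an edge that
is on the boundary of `F` and of no other face counts as having `F` on both sides. -/
noncomputable def sides (F : Set (ℝ × ℝ)) (e : Sym2 V) : ℕ :=
  open Classical in
  (if e ∈ D.boundaryEdges F then 1 else 0) +
    if e ∈ D.boundaryEdges F ∧ ∀ F', D.IsFace F' → e ∈ D.boundaryEdges F' → F' = F then 1 else 0

theorem sides_le_two (F : Set (ℝ × ℝ)) (e : Sym2 V) : D.sides F e ≤ 2 := by
  unfold sides
  split_ifs <;> omega

theorem sides_pos_iff {F : Set (ℝ × ℝ)} {e : Sym2 V} :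
    0 < D.sides F e ↔ e ∈ D.boundaryEdges F := by
  unfold sides
  split_ifs <;> simp_all

theorem sides_eq_two_iff {F : Set (ℝ × ℝ)} {e : Sym2 V} : D.sides F e = 2 ↔
    e ∈ D.boundaryEdges F ∧ ∀ F', D.IsFace F' → e ∈ D.boundaryEdges F' → F' = F := by
  unfold sides
  split_ifs with h1 h2 h2
  · exact ⟨fun _ => h2, fun _ => rfl⟩
  · simpa using h2
  · exact absurd h2.1 h1
  · simpa using h2

variable [Finite V]

/-- The finite set of the edges of `G`. -/
noncomputable def edges (G : SimpleGraph V) : Finset (Sym2 V) := G.edgeSet.toFinite.toFinset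

theorem mem_edges {e : Sym2 V} : e ∈ edges G ↔ e ∈ G.edgeSet := Set.Finite.mem_toFinset _

theorem card_edges : (edges G).card = G.edgeSet.ncard :=
  (ncard_eq_toFinset_card _ _).symm

theorem faceLength_eq_sum (F : Set (ℝ × ℝ)) : D.faceLength F = ∑ e ∈ edges G, D.sides F e := by
  classical
  unfold faceLength sides
  rw [Finset.sum_add_distrib, Finset.sum_boole, Finset.sum_boole]
  simp only [Nat.cast_id]
  congr 1
  · rw [← ncard_coe_finset]
    congr 1
    ext e
    simp only [Finset.coe_filter, mem_ofPred_eq, mem_edges]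
    exact ⟨fun h => ⟨h.1, h⟩, fun h => h.2⟩
  · rw [← ncard_coe_finset]
    congr 1
    ext e
    simp only [Finset.coe_filter, mem_ofPred_eq, mem_edges]
    exact ⟨fun h => ⟨h.1.1, h⟩, fun h => h.2⟩

/-- Every edge has only two sides. -/
theorem sum_sides_le_two {s : Finset (Set (ℝ × ℝ))} (hs : ∀ F ∈ s, D.IsFace F) (e : Sym2 V) :
    ∑ F ∈ s, D.sides F e ≤ 2 := by
  classical
  set s' := s.filter (fun F => e ∈ D.boundaryEdges F) with hs'
  have hsum : ∑ F ∈ s, D.sides F e = ∑ F ∈ s', D.sides F e := by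
    rw [hs', Finset.sum_filter]
    refine Finset.sum_congr rfl fun F _ => ?_
    split_ifs with h
    · rfl
    · exact Nat.eq_zero_of_not_pos (mt D.sides_pos_iff.1 h)
  rw [hsum]
  by_cases hone : ∃ F ∈ s', D.sides F e = 2
  · obtain ⟨F, hF, hF2⟩ := hone
    have : s' = {F} := Finset.eq_singleton_iff_unique_mem.2 ⟨hF, fun F' hF' =>
      (D.sides_eq_two_iff.1 hF2).2 F' (hs F' (Finset.mem_filter.1 hF').1)
        (Finset.mem_filter.1 hF').2⟩
    rw [this, Finset.sum_singleton, hF2]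
  · have hle : ∀ F ∈ s', D.sides F e ≤ 1 := fun F hF => by
      have h1 := D.sides_le_two F e
      have h2 : D.sides F e ≠ 2 := fun h => hone ⟨F, hF, h⟩
      omega
    have hcard : s'.card ≤ 2 := by
      by_contra! h
      obtain ⟨f⟩ : Nonempty (Fin 3 ↪ s') :=
        Function.Embedding.nonempty_of_card_le (by simpa using Nat.succ_le_of_lt h)
      obtain ⟨i, j, hij, heq⟩ := face_eq_or_of_mem_boundaryEdges (D := D) (e := e)
        (F := fun i => (f i : Set (ℝ × ℝ)))
        (fun i => hs _ (Finset.mem_filter.1 (f i).2).1) (fun i => (Finset.mem_filter.1 (f i).2).2)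
      exact hij (f.injective (Subtype.ext heq))
    calc ∑ F ∈ s', D.sides F e ≤ ∑ _F ∈ s', 1 := Finset.sum_le_sum hle
      _ = s'.card := by simp
      _ ≤ 2 := hcard

theorem sum_faceLength_le {s : Finset (Set (ℝ × ℝ))} (hs : ∀ F ∈ s, D.IsFace F) :
    ∑ F ∈ s, D.faceLength F ≤ 2 * G.edgeSet.ncard := by
  simp only [faceLength_eq_sum]
  rw [Finset.sum_comm, ← card_edges]
  calc ∑ e ∈ edges G, ∑ F ∈ s, D.sides F e ≤ ∑ _e ∈ edges G, 2 :=
        Finset.sum_le_sum fun e _ => D.sum_sides_le_two hs e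
    _ = 2 * (edges G).card := by rw [Finset.sum_const, smul_eq_mul, mul_comm]

open Classical in
/-- A face at a vertex that is not isolated contains at least one corner there, and each corner
has two sides. -/
theorem two_le_sum_sides {F : Set (ℝ × ℝ)} (hF : D.IsFace F) {v : V}
    (hv : D.point v ∈ closure F) (hne : (G.incidenceSet v).Nonempty) :
    2 ≤ ∑ e ∈ edges G with v ∈ e, D.sides F e := by
  rcases exists_boundaryEdges_of_point_mem hF hv hne with
    ⟨e, he, e', he', hee, heF, heF'⟩ | ⟨e, he, heF, huniq⟩
  · have hsub : ({e, e'} : Finset (Sym2 V)) ⊆ (edges G).filter (fun e => v ∈ e) := by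
      intro f hf
      rcases Finset.mem_insert.1 hf with rfl | hf
      · exact Finset.mem_filter.2 ⟨mem_edges.2 he.1, he.2⟩
      · rw [Finset.mem_singleton.1 hf]
        exact Finset.mem_filter.2 ⟨mem_edges.2 he'.1, he'.2⟩
    refine le_trans ?_ (Finset.sum_le_sum_of_subset hsub)
    rw [Finset.sum_pair hee]
    have := D.sides_pos_iff.2 heF
    have := D.sides_pos_iff.2 heF'
    omega
  · have hmem : e ∈ G.incidenceSet v := he ▸ rfl
    rw [← D.sides_eq_two_iff.2 ⟨heF, huniq⟩]
    exact Finset.single_le_sum (f := fun e => D.sides F e) (fun _ _ => Nat.zero_le _)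
      (Finset.mem_filter.2 ⟨mem_edges.2 hmem.1, hmem.2⟩)

/-- The vertices on the boundary of `F` that are not isolated. -/
def boundaryVertices (F : Set (ℝ × ℝ)) : Set V :=
  {v | D.point v ∈ closure F ∧ (G.incidenceSet v).Nonempty}

/-- Each vertex on `F` that is not isolated accounts for two sides of edges, and each edge has two
ends. -/
theorem ncard_boundaryVertices_le {F : Set (ℝ × ℝ)} (hF : D.IsFace F) :
    (D.boundaryVertices F).ncard ≤ D.faceLength F := by
  classical
  set A := (D.boundaryVertices F).toFinite.toFinset with hA
  have hAmem : ∀ v ∈ A, D.point v ∈ closure F ∧ (G.incidenceSet v).Nonempty := fun v hv =>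
    (D.boundaryVertices F).toFinite.mem_toFinset.1 hv
  have h1 : 2 * A.card ≤ ∑ v ∈ A, ∑ e ∈ edges G with v ∈ e, D.sides F e := by
    rw [mul_comm, ← smul_eq_mul]
    exact Finset.card_nsmul_le_sum _ _ _ fun v hv =>
      D.two_le_sum_sides hF (hAmem v hv).1 (hAmem v hv).2
  have h2 : ∑ v ∈ A, ∑ e ∈ edges G with v ∈ e, D.sides F e ≤
      ∑ e ∈ edges G, 2 * D.sides F e := by
    simp only [Finset.sum_filter]
    rw [Finset.sum_comm]
    refine Finset.sum_le_sum fun e _ => ?_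
    rw [← Finset.sum_filter, Finset.sum_const, smul_eq_mul]
    refine Nat.mul_le_mul_right _ ?_
    calc (A.filter (fun v => v ∈ e)).card ≤ e.toFinset.card := Finset.card_le_card fun v hv =>
          Sym2.mem_toFinset.2 (Finset.mem_filter.1 hv).2
      _ ≤ 2 := by
          rw [Sym2.card_toFinset]
          split_ifs <;> omega
  rw [← Finset.mul_sum, ← faceLength_eq_sum] at h2
  rw [ncard_eq_toFinset_card _ (D.boundaryVertices F).toFinite, ← hA]
  omega

/-- A face of length at most `2` is bounded by at most one edge, which is a component of the graph
and has this face on both sides; so it is the only face. -/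
theorem face_unique_of_faceLength_le_two {F : Set (ℝ × ℝ)} (hF : D.IsFace F)
    (hle : D.faceLength F ≤ 2) {F' : Set (ℝ × ℝ)} (hF' : D.IsFace F') : F' = F := by
  classical
  rw [faceLength_eq_sum] at hle
  have hw : ∀ e ∈ D.boundaryEdges F, D.sides F e = 2 := by
    intro e he
    induction e using Sym2.ind with | h u v =>
    have huv : u ≠ v := G.ne_of_adj he.1
    have hin : ∀ w ∈ s(u, v), 2 ≤ ∑ e ∈ edges G with w ∈ e, D.sides F e := fun w hw =>
      D.two_le_sum_sides hF (frontier_subset_closure (he.2 (D.point_mem_arc he.1 hw)))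
        ⟨_, he.1, hw⟩
    have hu := hin u (Sym2.mem_mk_left u v)
    have hv := hin v (Sym2.mem_mk_right u v)
    -- only the edge itself contains both ends
    have hboth : ∑ e ∈ edges G with u ∈ e, D.sides F e + ∑ e ∈ edges G with v ∈ e, D.sides F e ≤
        ∑ e ∈ edges G, (D.sides F e + if e = s(u, v) then D.sides F e else 0) := by
      rw [Finset.sum_filter, Finset.sum_filter, ← Finset.sum_add_distrib]
      refine Finset.sum_le_sum fun e _ => ?_
      have := (Sym2.mem_and_mem_iff (z := e) huv).1
      split_ifs with h1 h2 h3 h3 h3 <;> first | omega | exact absurd (this ⟨h1, h2⟩) h3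
    rw [Finset.sum_add_distrib, Finset.sum_ite_eq', if_pos (mem_edges.2 he.1)] at hboth
    have := D.sides_le_two F s(u, v)
    omega
  refine face_unique hF (fun e he => (D.sides_eq_two_iff.1 (hw e he)).2) (fun v hv => ?_) hF'
  rcases (G.incidenceSet v).eq_empty_or_nonempty with h | h
  · rw [h]; exact subsingleton_empty
  rcases exists_boundaryEdges_of_point_mem hF hv h with
    ⟨e, he, e', he', hee, heF, heF'⟩ | ⟨e, he, -⟩
  · have hsub : ({e, e'} : Finset (Sym2 V)) ⊆ edges G := by
      intro f hf
      rcases Finset.mem_insert.1 hf with rfl | hf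
      · exact mem_edges.2 he.1
      · rw [Finset.mem_singleton.1 hf]
        exact mem_edges.2 he'.1
    have := Finset.sum_le_sum_of_subset (f := fun e => D.sides F e) hsub
    rw [Finset.sum_pair hee, hw e heF, hw e' heF'] at this
    omega
  · rw [he]; exact subsingleton_singleton

/-- The upper bound for the number of edges. Isolated vertices only help, because they do not enter
the bound `ncard_edgeSet_add_two_le` for the number of faces. -/
theorem four_mul_ncard_edgeSet_le [Nonempty V] (h : D.EveryVertexBounds 4) :
    4 * G.edgeSet.ncard + 24 ≤ 11 * Nat.card V := by
  classical
  have : Fintype V := Fintype.ofFinite V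
  obtain ⟨v₀⟩ := ‹Nonempty V›
  obtain ⟨F₀, hF₀, -, hlen₀⟩ := h v₀
  have hthree : ∀ F, D.IsFace F → 3 ≤ D.faceLength F := by
    intro F hF
    by_contra! hlt
    have := D.face_unique_of_faceLength_le_two hF (by omega) hF₀
    rw [this] at hlen₀
    omega
  have hE : G.edgeSet.Nonempty := by
    rw [nonempty_iff_ne_empty]
    intro h0
    have : edges G = ∅ := by
      ext e
      rw [mem_edges, h0]
      simp
    rw [faceLength_eq_sum, this, Finset.sum_empty] at hlen₀
    omega
  have hfin : {F | D.IsFace F}.Finite := by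
    by_contra hinf
    obtain ⟨s, hs, hcard⟩ := Set.Infinite.exists_subset_card_eq hinf (G.edgeSet.ncard + 1)
    have h1 := D.sum_faceLength_le (s := s) fun F hF => hs hF
    have h2 : _ ≤ ∑ F ∈ s, D.faceLength F :=
      Finset.card_nsmul_le_sum s D.faceLength 3 fun F hF => hthree F (hs hF)
    rw [smul_eq_mul] at h2
    omega
  set s := hfin.toFinset with hs
  have hmem : ∀ F ∈ s, D.IsFace F := fun F hF => hfin.mem_toFinset.1 hF
  have heuler := D.ncard_edgeSet_add_two_le hfin hE
  have hsum := D.sum_faceLength_le hmem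
  rw [ncard_eq_toFinset_card _ hfin, ← hs] at heuler
  set N : Set V := {v | (G.incidenceSet v).Nonempty} with hN
  have hNle : N.ncard ≤ Nat.card V := ncard_le_card N
  -- the vertices of `N` are spread over the faces of length at least `4`
  have hcover : N.ncard ≤ ∑ F ∈ s with 4 ≤ D.faceLength F, D.faceLength F := by
    calc N.ncard ≤ (⋃ F ∈ s.filter (fun F => 4 ≤ D.faceLength F), D.boundaryVertices F).ncard := by
          refine ncard_le_ncard (fun v hv => ?_) (toFinite _)
          obtain ⟨F, hF, hvF, hlen⟩ := h v
          exact mem_iUnion₂.2 ⟨F, Finset.mem_filter.2 ⟨hfin.mem_toFinset.2 hF, hlen⟩,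
            frontier_subset_closure hvF, hv⟩
      _ ≤ ∑ F ∈ s with 4 ≤ D.faceLength F, (D.boundaryVertices F).ncard :=
          Finset.set_ncard_biUnion_le _ _
      _ ≤ _ := Finset.sum_le_sum fun F hF =>
          D.ncard_boundaryVertices_le (hmem F (Finset.mem_filter.1 hF).1)
  -- a face of length `L ≥ 4` exceeds a triangle by `L - 3 ≥ L / 4`
  have hexcess : 12 * s.card + ∑ F ∈ s with 4 ≤ D.faceLength F, D.faceLength F ≤
      4 * ∑ F ∈ s, D.faceLength F := by
    rw [Finset.sum_filter, Finset.mul_sum, mul_comm, ← smul_eq_mul, ← Finset.sum_const,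
      ← Finset.sum_add_distrib]
    refine Finset.sum_le_sum fun F hF => ?_
    have := hthree F (hmem F hF)
    split_ifs <;> omega
  omega

end PlaneDrawing

/-! ### Drawings built up vertex by vertex -/

/-- A straight-line drawing of a graph on `ℕ`, given by adding the vertices one after another. -/
structure IncrementalDrawing where
  /-- the point that represents a vertex -/
  pt : ℕ → ℝ × ℝ
  /-- the neighbours of a vertex among the preceding vertices -/
  nb : ℕ → Finset ℕ
  /-- a region that is not met by the drawing of the vertices before the given one -/
  region : ℕ → Set (ℝ × ℝ)
  nb_lt : ∀ m, ∀ i ∈ nb m, i < m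
  pt_mem : ∀ m, pt m ∈ region m
  segment_subset : ∀ m, ∀ i ∈ nb m, ∀ z ∈ segment ℝ (pt m) (pt i), z ≠ pt i → z ∈ region m
  region_succ_subset : ∀ m, region (m + 1) ⊆ region m
  pt_notMem : ∀ m, pt m ∉ region (m + 1)
  segment_disjoint : ∀ m, ∀ i ∈ nb m, ∀ z ∈ segment ℝ (pt m) (pt i), z ∉ region (m + 1)
  segment_inter : ∀ m, ∀ i ∈ nb m, ∀ j ∈ nb m, i ≠ j → ∀ z ∈ segment ℝ (pt m) (pt i),
    z ∈ segment ℝ (pt m) (pt j) → z = pt m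

/-- The triangle `c P A` without its side `[P, A]`: the set of convex combinations of its corners in
which `c` has positive weight. -/
def fan (c P A : ℝ × ℝ) : Set (ℝ × ℝ) :=
  {z | ∃ t u v : ℝ, 0 < t ∧ 0 ≤ u ∧ 0 ≤ v ∧ t + u + v = 1 ∧ z = t • c + u • P + v • A}

theorem center_mem_fan (c P A : ℝ × ℝ) : c ∈ fan c P A :=
  ⟨1, 0, 0, one_pos, le_rfl, le_rfl, by norm_num, by simp⟩

theorem convex_fan (c P A : ℝ × ℝ) : Convex ℝ (fan c P A) := by
  rintro _ ⟨t, u, v, ht, hu, hv, h, rfl⟩ _ ⟨t', u', v', ht', hu', hv', h', rfl⟩ a b ha hb hab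
  refine ⟨a * t + b * t', a * u + b * u', a * v + b * v', ?_, by positivity, by positivity,
    ?_, ?_⟩
  · rcases ha.eq_or_lt with rfl | ha
    · have : b = 1 := by linarith
      subst this
      linarith
    · have := mul_pos ha ht
      have := mul_nonneg hb ht'.le
      linarith
  · linear_combination a * h + b * h' + hab
  · module

theorem segment_subset_closure_fan (c P A : ℝ × ℝ) : segment ℝ P A ⊆ closure (fan c P A) := by
  rintro _ ⟨u, v, hu, hv, huv, rfl⟩
  have hcont : Continuous fun t : ℝ => t • c + ((1 - t) * u) • P + ((1 - t) * v) • A := by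
    fun_prop
  have hmem : (0 : ℝ) ∈ closure (Ioc 0 1) := by
    rw [closure_Ioc zero_ne_one]
    exact ⟨le_rfl, zero_le_one⟩
  refine closure_mono ?_ (image_closure_subset_closure_image hcont ⟨0, hmem, by simp⟩)
  rintro _ ⟨t, ⟨ht, ht1⟩, rfl⟩
  have h1 : 0 ≤ 1 - t := by linarith
  refine ⟨t, _, _, ht, mul_nonneg h1 hu, mul_nonneg h1 hv, ?_, rfl⟩
  linear_combination (1 - t) * huv

namespace IncrementalDrawing

variable (I : IncrementalDrawing)

/-- The points covered by the vertices before `n` and the edges between them. -/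
def covered (n : ℕ) : Set (ℝ × ℝ) :=
  {z | ∃ j < n, z = I.pt j ∨ ∃ i ∈ I.nb j, z ∈ segment ℝ (I.pt j) (I.pt i)}

theorem region_antitone : Antitone I.region := antitone_nat_of_succ_le I.region_succ_subset

theorem disjoint_covered_region (n : ℕ) : Disjoint (I.covered n) (I.region n) := by
  rw [Set.disjoint_left]
  rintro z ⟨j, hj, h⟩ hz
  have hz' : z ∈ I.region (j + 1) := I.region_antitone hj hz
  rcases h with rfl | ⟨i, hi, hzi⟩
  · exact I.pt_notMem j hz'
  · exact I.segment_disjoint j i hi z hzi hz'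

theorem pt_notMem_covered (n : ℕ) : I.pt n ∉ I.covered n := fun h =>
  Set.disjoint_left.1 (I.disjoint_covered_region n) h (I.pt_mem n)

theorem pt_mem_covered {j n : ℕ} (hj : j < n) : I.pt j ∈ I.covered n := ⟨j, hj, Or.inl rfl⟩

theorem pt_injective : Function.Injective I.pt := by
  intro i j h
  by_contra hne
  rcases lt_or_gt_of_ne hne with hlt | hlt
  · exact I.pt_notMem_covered j (h ▸ I.pt_mem_covered hlt)
  · exact I.pt_notMem_covered i (h ▸ I.pt_mem_covered hlt)

/-- Everything that is drawn after stage `m` lies in the region that is free at this stage. -/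
theorem covered_subset (m n : ℕ) : I.covered n ⊆ I.covered m ∪ I.region m := by
  rintro z ⟨j, hj, hz⟩
  by_cases hjm : j < m
  · exact Or.inl ⟨j, hjm, hz⟩
  rcases hz with rfl | ⟨i, hi, hzi⟩
  · exact Or.inr (I.region_antitone (not_lt.1 hjm) (I.pt_mem j))
  · by_cases hzp : z = I.pt i
    · by_cases him : i < m
      · exact Or.inl ⟨i, him, Or.inl hzp⟩
      · exact Or.inr (I.region_antitone (not_lt.1 him) (hzp ▸ I.pt_mem i))
    · exact Or.inr (I.region_antitone (not_lt.1 hjm) (I.segment_subset j i hi z hzi hzp))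

theorem eq_or_eq_of_pt_mem_segment {i j k : ℕ} (hi : i ∈ I.nb j)
    (h : I.pt k ∈ segment ℝ (I.pt j) (I.pt i)) : k = i ∨ k = j := by
  rcases lt_trichotomy k j with hk | hk | hk
  · left
    by_contra hki
    exact Set.disjoint_left.1 (I.disjoint_covered_region j) (I.pt_mem_covered hk)
      (I.segment_subset j i hi _ h (I.pt_injective.ne hki))
  · exact Or.inr hk
  · exact absurd ⟨j, hk, Or.inr ⟨i, hi, h⟩⟩ (I.pt_notMem_covered k)

/-- An edge that is added later meets an earlier one only in a common end. -/
theorem exists_common_end_of_lt {i j i' j' : ℕ} (hi : i ∈ I.nb j) (hi' : i' ∈ I.nb j')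
    (hlt : j < j') {z : ℝ × ℝ} (hz : z ∈ segment ℝ (I.pt j) (I.pt i))
    (hz' : z ∈ segment ℝ (I.pt j') (I.pt i')) : z = I.pt i' ∧ (i' = i ∨ i' = j) := by
  have h1 : z = I.pt i' := by
    by_contra hne
    exact Set.disjoint_left.1 (I.disjoint_covered_region j') ⟨j, hlt, Or.inr ⟨i, hi, hz⟩⟩
      (I.segment_subset j' i' hi' z hz' hne)
  exact ⟨h1, I.eq_or_eq_of_pt_mem_segment hi (h1 ▸ hz)⟩

/-- The graph on the first `n` vertices. -/
def graph (n : ℕ) : SimpleGraph (Fin n) where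
  Adj i j := (i : ℕ) ∈ I.nb j ∨ (j : ℕ) ∈ I.nb i
  symm := ⟨fun _ _ h => h.symm⟩
  loopless := ⟨fun i h => by
    rcases h with h | h <;> exact lt_irrefl _ (I.nb_lt _ _ h)⟩

/-- The segment between the ends of an edge. -/
def arc {n : ℕ} : Sym2 (Fin n) → Set (ℝ × ℝ) :=
  Sym2.lift ⟨fun i j => segment ℝ (I.pt i) (I.pt j), fun _ _ => segment_symm ℝ _ _⟩

theorem arc_mk {n : ℕ} (i j : Fin n) : I.arc s(i, j) = segment ℝ (I.pt j) (I.pt i) :=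
  segment_symm ℝ _ _

theorem exists_of_mem_edgeSet {n : ℕ} {e : Sym2 (Fin n)} (he : e ∈ (I.graph n).edgeSet) :
    ∃ i j : Fin n, e = s(i, j) ∧ (i : ℕ) ∈ I.nb j := by
  induction e using Sym2.ind with | h i j =>
  rcases he with h | h
  · exact ⟨i, j, rfl, h⟩
  · exact ⟨j, i, Sym2.eq_swap, h⟩

/-- The drawing of the graph on the first `n` vertices. -/
def drawing (n : ℕ) : PlaneDrawing (I.graph n) where
  point i := I.pt i
  arc := I.arc
  point_injective := fun i j h => Fin.ext (I.pt_injective h)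
  arc_isPolygonalArc := by
    intro e he
    obtain ⟨i, j, rfl, hij⟩ := I.exists_of_mem_edgeSet he
    refine ⟨j, i, Sym2.eq_swap, [I.pt j, I.pt i],
      ⟨I.pt_injective.ne (I.nb_lt _ _ hij).ne', ?_, trivial⟩, rfl, rfl, ?_⟩
    · exact inter_eq_right.2 (singleton_subset_iff.2 (right_mem_segment ℝ _ _))
    · rw [arc_mk]
      exact polyline_pair _ _
  mem_of_point_mem_arc := by
    intro e he v hv
    obtain ⟨i, j, rfl, hij⟩ := I.exists_of_mem_edgeSet he
    rw [arc_mk] at hv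
    rw [Sym2.mem_iff, Fin.ext_iff, Fin.ext_iff]
    exact I.eq_or_eq_of_pt_mem_segment hij hv
  arc_inter_arc := by
    rintro e he e' he' hne z ⟨hz, hz'⟩
    obtain ⟨i, j, rfl, hij⟩ := I.exists_of_mem_edgeSet he
    obtain ⟨i', j', rfl, hij'⟩ := I.exists_of_mem_edgeSet he'
    rw [arc_mk] at hz hz'
    rcases lt_trichotomy (j : ℕ) j' with h | h | h
    · obtain ⟨h1, h2⟩ := I.exists_common_end_of_lt hij hij' h hz hz'
      rw [← Fin.ext_iff, ← Fin.ext_iff] at h2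
      exact ⟨i', Sym2.mem_iff.2 h2, Sym2.mem_mk_left _ _, h1.symm⟩
    · obtain rfl : j = j' := Fin.ext h
      have hii : (i : ℕ) ≠ i' := fun h => hne (by rw [Fin.ext h])
      exact ⟨j, Sym2.mem_mk_right _ _, Sym2.mem_mk_right _ _,
        (I.segment_inter j i hij i' hij' hii z hz hz').symm⟩
    · obtain ⟨h1, h2⟩ := I.exists_common_end_of_lt hij' hij h hz' hz
      rw [← Fin.ext_iff, ← Fin.ext_iff] at h2
      exact ⟨i, Sym2.mem_mk_left _ _, Sym2.mem_iff.2 h2, h1.symm⟩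

theorem support_drawing_subset (n : ℕ) : (I.drawing n).support ⊆ I.covered n := by
  rintro z (⟨j, rfl⟩ | hz)
  · exact ⟨j, j.2, Or.inl rfl⟩
  · obtain ⟨e, he, hz⟩ := mem_iUnion₂.1 hz
    obtain ⟨i, j, rfl, hij⟩ := I.exists_of_mem_edgeSet he
    change z ∈ I.arc _ at hz
    rw [arc_mk] at hz
    exact ⟨j, j.2, Or.inr ⟨i, hij, hz⟩⟩

theorem ncard_edgeSet_graph (n : ℕ) :
    (I.graph n).edgeSet.ncard = ∑ j ∈ Finset.range n, (I.nb j).card := by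
  classical
  have hinj : Function.Injective (Sym2.map (Fin.val : Fin n → ℕ)) :=
    Sym2.map.injective Fin.val_injective
  set T := (Finset.range n).sigma I.nb with hT
  have himg : Sym2.map Fin.val '' (I.graph n).edgeSet =
      (fun x : (_ : ℕ) × ℕ => s(x.2, x.1)) '' (T : Set ((_ : ℕ) × ℕ)) := by
    ext e
    constructor
    · rintro ⟨e, he, rfl⟩
      obtain ⟨i, j, rfl, hij⟩ := I.exists_of_mem_edgeSet he
      exact ⟨⟨j, i⟩, Finset.mem_coe.2 (Finset.mem_sigma.2 ⟨Finset.mem_range.2 j.2, hij⟩), rfl⟩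
    · rintro ⟨⟨j, i⟩, h, rfl⟩
      obtain ⟨hj, hi⟩ := Finset.mem_sigma.1 (Finset.mem_coe.1 h)
      have hj := Finset.mem_range.1 hj
      exact ⟨s(⟨i, (I.nb_lt j i hi).trans hj⟩, ⟨j, hj⟩), Or.inl hi, rfl⟩
  have hinj' : InjOn (fun x : (_ : ℕ) × ℕ => s(x.2, x.1)) (T : Set ((_ : ℕ) × ℕ)) := by
    rintro ⟨j, i⟩ h ⟨j', i'⟩ h' heq
    have hi := I.nb_lt j i (Finset.mem_sigma.1 (Finset.mem_coe.1 h)).2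
    have hi' := I.nb_lt j' i' (Finset.mem_sigma.1 (Finset.mem_coe.1 h')).2
    rcases Sym2.eq_iff.1 heq with ⟨h1, h2⟩ | ⟨h1, h2⟩
    · simp only at h1 h2
      rw [h1, h2]
    · simp only at h1 h2
      omega
  rw [← ncard_image_of_injective _ hinj, himg, hinj'.ncard_image, ncard_coe_finset,
    Finset.card_sigma]

/-- A `4`-cycle `P A Q B` whose sides are all seen from a point `c` off the drawing lies on the
boundary of a face of length at least `4`. -/
theorem exists_face {n : ℕ} {P Q A B : Fin n} (hPQ : P ≠ Q) (hAB : A ≠ B) (hPB : P ≠ B)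
    (hQB : Q ≠ B) (hPA : (I.graph n).Adj P A)
    (hPB' : (I.graph n).Adj P B) (hQA : (I.graph n).Adj Q A) (hQB' : (I.graph n).Adj Q B)
    {c : ℝ × ℝ} {X : Set (ℝ × ℝ)} (hX : Disjoint (I.covered n) X)
    (h1 : fan c (I.pt P) (I.pt A) ⊆ X) (h2 : fan c (I.pt P) (I.pt B) ⊆ X)
    (h3 : fan c (I.pt Q) (I.pt A) ⊆ X) (h4 : fan c (I.pt Q) (I.pt B) ⊆ X) :
    ∃ F, (I.drawing n).IsFace F ∧ 4 ≤ (I.drawing n).faceLength F ∧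
      ∀ w ∈ ({P, Q, A, B} : Set (Fin n)), (I.drawing n).point w ∈ frontier F := by
  classical
  set D := I.drawing n with hD
  have hXc : X ⊆ D.supportᶜ := fun z hz hs =>
    Set.disjoint_left.1 hX (I.support_drawing_subset n hs) hz
  have hc : c ∈ D.supportᶜ := hXc (h1 (center_mem_fan _ _ _))
  set F := connectedComponentIn D.supportᶜ c with hF
  have hface : D.IsFace F := ⟨c, hc, rfl⟩
  have hbd : ∀ i j : Fin n, (I.graph n).Adj i j → fan c (I.pt i) (I.pt j) ⊆ X →
      s(i, j) ∈ D.boundaryEdges F := by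
    intro i j hij hfan
    have hsub : fan c (I.pt i) (I.pt j) ⊆ F :=
      (convex_fan _ _ _).isPreconnected.subset_connectedComponentIn (center_mem_fan _ _ _)
        (hfan.trans hXc)
    refine ⟨hij, fun z hz => ?_⟩
    rw [PlaneDrawing.mem_frontier_iff hface (D.arc_subset_support hij hz)]
    exact closure_mono hsub (segment_subset_closure_fan _ _ _ hz)
  have e1 := hbd P A hPA h1
  have e2 := hbd P B hPB' h2
  have e3 := hbd Q A hQA h3
  have e4 := hbd Q B hQB' h4
  refine ⟨F, hface, ?_, ?_⟩
  · have hsub : (({s(P, A), s(P, B), s(Q, A), s(Q, B)} : Finset (Sym2 (Fin n))) : Set _) ⊆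
        D.boundaryEdges F := by
      intro e he
      simp only [Finset.coe_insert, Finset.coe_singleton, mem_insert_iff, mem_singleton_iff] at he
      rcases he with rfl | rfl | rfl | rfl <;> assumption
    have hcard := ncard_le_ncard hsub (toFinite _)
    have hfour : ({s(P, A), s(P, B), s(Q, A), s(Q, B)} : Finset (Sym2 (Fin n))).card = 4 := by
      have hPA := hPA.ne
      have hQA := hQA.ne
      rw [Finset.card_insert_of_notMem, Finset.card_insert_of_notMem,
        Finset.card_insert_of_notMem, Finset.card_singleton] <;>
      · simp only [Finset.mem_insert, Finset.mem_singleton, Sym2.eq_iff]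
        tauto
    rw [ncard_coe_finset, hfour] at hcard
    exact hcard.trans (Nat.le_add_right _ _)
  · have hpt : ∀ i j : Fin n, s(i, j) ∈ D.boundaryEdges F →
        D.point i ∈ frontier F ∧ D.point j ∈ frontier F := fun i j h =>
      ⟨h.2 (D.point_mem_arc h.1 (Sym2.mem_mk_left _ _)),
        h.2 (D.point_mem_arc h.1 (Sym2.mem_mk_right _ _))⟩
    rintro w (rfl | rfl | rfl | rfl)
    · exact (hpt _ _ e1).1
    · exact (hpt _ _ e3).1
    · exact (hpt _ _ e1).2
    · exact (hpt _ _ e2).2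

end IncrementalDrawing

/-! ### The extremal drawing -/

/-- The points between the graphs of `α * (1 - |x|)` and `β * (1 - |x|)`. -/
def chevron (α β : ℝ) : Set (ℝ × ℝ) :=
  {z | α * (1 - |z.1|) < z.2 ∧ z.2 < β * (1 - |z.1|)}

/-- The quadrilateral with vertices `(0, 1)`, `(-1/4, 1)`, `(0, 2)` and `(1, 0)`. -/
def halfKite : Set (ℝ × ℝ) :=
  {z | (z.1 ≤ 0 → 1 < z.2 ∧ z.2 < 2 + 4 * z.1) ∧ (0 ≤ z.1 → 1 - z.1 < z.2 ∧ z.2 < 2 - 2 * z.1)}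

/-- The quadrilateral with vertices `(0, 1)`, `(-1/4, 1)`, `(0, 2)` and `(1/4, 1)`. -/
def kite : Set (ℝ × ℝ) :=
  {z | 1 < z.2 ∧ z.2 < 2 - 4 * |z.1|}

/-- The dilation of the second coordinate that maps the `k`-th block of the drawing to a standard
position. -/
def rescale (k : ℕ) (z : ℝ × ℝ) : ℝ × ℝ := (z.1, 4 ^ k * z.2)

theorem rescale_injective (k : ℕ) : Function.Injective (rescale k) := by
  intro z w h
  have h1 : z.1 = w.1 := (Prod.ext_iff.1 h).1
  have h2 : (4 : ℝ) ^ k * z.2 = 4 ^ k * w.2 := (Prod.ext_iff.1 h).2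
  exact Prod.ext h1 (mul_left_cancel₀ (by positivity) h2)

theorem exists_of_mem_segment (k : ℕ) {P Q z : ℝ × ℝ} (hz : z ∈ segment ℝ P Q) :
    ∃ u v : ℝ, 0 ≤ u ∧ 0 ≤ v ∧ u + v = 1 ∧ (z ≠ Q → 0 < u) ∧
      (rescale k z).1 = u * (rescale k P).1 + v * (rescale k Q).1 ∧
      (rescale k z).2 = u * (rescale k P).2 + v * (rescale k Q).2 := by
  obtain ⟨u, v, hu, hv, huv, rfl⟩ := hz
  refine ⟨u, v, hu, hv, huv, fun hne => lt_of_le_of_ne hu ?_, by simp [rescale], ?_⟩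
  · rintro rfl
    apply hne
    have : v = 1 := by linarith
    simp [this]
  · simp only [rescale, Prod.snd_add, Prod.smul_snd, smul_eq_mul]
    ring

theorem exists_of_mem_fan (k : ℕ) {c P A z : ℝ × ℝ} (hz : z ∈ fan c P A) :
    ∃ t u v : ℝ, 0 < t ∧ 0 ≤ u ∧ 0 ≤ v ∧ t + u + v = 1 ∧
      (rescale k z).1 = t * (rescale k c).1 + u * (rescale k P).1 + v * (rescale k A).1 ∧
      (rescale k z).2 = t * (rescale k c).2 + u * (rescale k P).2 + v * (rescale k A).2 := by
  obtain ⟨t, u, v, ht, hu, hv, h, rfl⟩ := hz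
  refine ⟨t, u, v, ht, hu, hv, h, by simp [rescale], ?_⟩
  simp only [rescale, Prod.snd_add, Prod.smul_snd, smul_eq_mul]
  ring

/-- The points that represent the vertices of the extremal graphs. The vertices `1` and `2` are the
ends of the base of all triangles, and `3` lies above the first triangle `0, 1, 2`. For
`k ≥ 1`, the vertices `4k`, `4k + 1`, `4k + 2`, `4k + 3` are placed into the triangle
`1, 2, 4(k - 1)`; the vertex `4k` is then the apex of the next triangle. -/
noncomputable def blockPt (m : ℕ) : ℝ × ℝ :=
  if m = 1 then (-1, 0) else if m = 2 then (1, 0) else if m = 3 then (0, 2) else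
  if m % 4 = 0 then (0, (1 / 4) ^ (m / 4)) else
  if m % 4 = 1 then (0, 2 * (1 / 4) ^ (m / 4)) else
  if m % 4 = 2 then (-(1 / 4), (1 / 4) ^ (m / 4)) else (1 / 4, (1 / 4) ^ (m / 4))

/-- The preceding neighbours of the vertices of the extremal graphs. -/
def blockNb (m : ℕ) : Finset ℕ :=
  if m = 0 then ∅ else if m = 1 then {0} else if m = 2 then {0, 1} else if m = 3 then {1, 2} else
  if m % 4 = 0 then {1, 2} else if m % 4 = 1 then {1, 2, m - 5} else
  if m % 4 = 2 then {1, m - 2, m - 1} else {2, m - 3, m - 2}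

/-- The faces into which the vertex `m` and those after it are placed: the triangle on the base, and
the quadrilateral that the block of `m` has left open. For `m < 3` these are the points off the
part of the triangle `0, 1, 2` drawn so far, and for `m = 3` the points above this triangle or
inside it. -/
def blockRegion (m : ℕ) : Set (ℝ × ℝ) :=
  if m = 0 then univ else if m = 1 then {z | z ≠ (0, 1)} else
  if m = 2 then {z | z.2 = 1 + z.1 → -1 ≤ z.1 → 0 < z.1} else
  if m = 3 then {z | 1 - |z.1| < z.2} ∪ chevron 0 1 else
  rescale (m / 4) ⁻¹' (if m % 4 = 0 then chevron 0 4 else chevron 0 1 ∪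
    if m % 4 = 1 then chevron 1 4 else if m % 4 = 2 then chevron 1 2 else halfKite)

section values

variable (k : ℕ)

theorem pow_mul_inv_pow : (4 : ℝ) ^ k * (1 / 4) ^ k = 1 := by
  rw [← mul_pow]; norm_num

theorem rescale_blockPt_one : rescale k (blockPt 1) = (-1, 0) := by
  simp [rescale, blockPt]

theorem rescale_blockPt_two : rescale k (blockPt 2) = (1, 0) := by
  simp [rescale, blockPt]

theorem blockPt_four_mul : blockPt (4 * k) = (0, (1 / 4) ^ k) := by
  rw [blockPt, if_neg (by omega), if_neg (by omega), if_neg (by omega), if_pos (by omega),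
    show 4 * k / 4 = k by omega]

theorem rescale_blockPt_zero : rescale k (blockPt (4 * k)) = (0, 1) := by
  rw [blockPt_four_mul, rescale, pow_mul_inv_pow]

theorem rescale_blockPt_prev : rescale (k + 1) (blockPt (4 * k)) = (0, 4) := by
  rw [blockPt_four_mul, rescale, pow_succ, mul_right_comm, pow_mul_inv_pow, one_mul]

theorem rescale_blockPt_add_one :
    rescale (k + 1) (blockPt (4 * (k + 1) + 1)) = (0, 2) := by
  rw [blockPt, if_neg (by omega), if_neg (by omega), if_neg (by omega), if_neg (by omega),
    if_pos (by omega), show (4 * (k + 1) + 1) / 4 = k + 1 by omega, rescale, mul_left_comm,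
    pow_mul_inv_pow, mul_one]

theorem rescale_blockPt_add_two :
    rescale (k + 1) (blockPt (4 * (k + 1) + 2)) = (-(1 / 4), 1) := by
  rw [blockPt, if_neg (by omega), if_neg (by omega), if_neg (by omega), if_neg (by omega),
    if_neg (by omega), if_pos (by omega), show (4 * (k + 1) + 2) / 4 = k + 1 by omega, rescale,
    pow_mul_inv_pow]

theorem rescale_blockPt_add_three :
    rescale (k + 1) (blockPt (4 * (k + 1) + 3)) = (1 / 4, 1) := by
  rw [blockPt, if_neg (by omega), if_neg (by omega), if_neg (by omega), if_neg (by omega),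
    if_neg (by omega), if_neg (by omega), show (4 * (k + 1) + 3) / 4 = k + 1 by omega, rescale,
    pow_mul_inv_pow]

theorem blockNb_four_mul : blockNb (4 * (k + 1)) = {1, 2} := by
  rw [blockNb, if_neg (by omega), if_neg (by omega), if_neg (by omega), if_neg (by omega),
    if_pos (by omega)]

theorem blockNb_add_one : blockNb (4 * (k + 1) + 1) = {1, 2, 4 * k} := by
  rw [blockNb, if_neg (by omega), if_neg (by omega), if_neg (by omega), if_neg (by omega),
    if_neg (by omega), if_pos (by omega), show 4 * (k + 1) + 1 - 5 = 4 * k by omega]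

theorem blockNb_add_two :
    blockNb (4 * (k + 1) + 2) = {1, 4 * (k + 1), 4 * (k + 1) + 1} := by
  rw [blockNb, if_neg (by omega), if_neg (by omega), if_neg (by omega), if_neg (by omega),
    if_neg (by omega), if_neg (by omega), if_pos (by omega)]
  rfl

theorem blockNb_add_three :
    blockNb (4 * (k + 1) + 3) = {2, 4 * (k + 1), 4 * (k + 1) + 1} := by
  rw [blockNb, if_neg (by omega), if_neg (by omega), if_neg (by omega), if_neg (by omega),
    if_neg (by omega), if_neg (by omega), if_neg (by omega)]
  rfl

theorem blockRegion_four_mul :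
    blockRegion (4 * (k + 1)) = rescale (k + 1) ⁻¹' chevron 0 4 := by
  rw [blockRegion, if_neg (by omega), if_neg (by omega), if_neg (by omega), if_neg (by omega),
    if_pos (by omega), show 4 * (k + 1) / 4 = k + 1 by omega]

/-- The last region of a block, in the scale of this block. -/
theorem blockRegion_next : blockRegion (4 * (k + 1)) = rescale k ⁻¹' chevron 0 1 := by
  rw [blockRegion_four_mul]
  ext z
  simp only [chevron, rescale, mem_preimage, mem_ofPred_eq, pow_succ]
  constructor <;> rintro ⟨h1, h2⟩ <;> constructor <;> linarith

theorem blockRegion_add_one :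
    blockRegion (4 * (k + 1) + 1) = rescale (k + 1) ⁻¹' (chevron 0 1 ∪ chevron 1 4) := by
  rw [blockRegion, if_neg (by omega), if_neg (by omega), if_neg (by omega), if_neg (by omega),
    if_neg (by omega), if_pos (by omega), show (4 * (k + 1) + 1) / 4 = k + 1 by omega]

theorem blockRegion_add_two :
    blockRegion (4 * (k + 1) + 2) = rescale (k + 1) ⁻¹' (chevron 0 1 ∪ chevron 1 2) := by
  rw [blockRegion, if_neg (by omega), if_neg (by omega), if_neg (by omega), if_neg (by omega),
    if_neg (by omega), if_neg (by omega), if_pos (by omega),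
    show (4 * (k + 1) + 2) / 4 = k + 1 by omega]

theorem blockRegion_add_three :
    blockRegion (4 * (k + 1) + 3) = rescale (k + 1) ⁻¹' (chevron 0 1 ∪ halfKite) := by
  rw [blockRegion, if_neg (by omega), if_neg (by omega), if_neg (by omega), if_neg (by omega),
    if_neg (by omega), if_neg (by omega), if_neg (by omega),
    show (4 * (k + 1) + 3) / 4 = k + 1 by omega]

end values

/-- Every number is below `4` or belongs to a block of four numbers. -/
theorem block_cases (m : ℕ) : m = 0 ∨ m = 1 ∨ m = 2 ∨ m = 3 ∨
    ∃ k, m = 4 * (k + 1) ∨ m = 4 * (k + 1) + 1 ∨ m = 4 * (k + 1) + 2 ∨ m = 4 * (k + 1) + 3 := by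
  by_cases h : m < 4
  · omega
  · have : m = 4 * (m / 4 - 1 + 1) + m % 4 := by omega
    have := Nat.mod_lt m (show 4 > 0 by norm_num)
    exact Or.inr (Or.inr (Or.inr (Or.inr ⟨m / 4 - 1, by omega⟩)))

theorem blockNb_lt (m : ℕ) : ∀ i ∈ blockNb m, i < m := by
  intro i hi
  rcases block_cases m with rfl | rfl | rfl | rfl | ⟨k, rfl | rfl | rfl | rfl⟩
  · simp [blockNb] at hi
  · simp [blockNb] at hi; omega
  · simp [blockNb] at hi; omega
  · simp [blockNb] at hi; omega
  · rw [blockNb_four_mul] at hi; simp at hi; omega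
  · rw [blockNb_add_one] at hi; simp at hi; omega
  · rw [blockNb_add_two] at hi; simp at hi; omega
  · rw [blockNb_add_three] at hi; simp at hi; omega

theorem blockPt_mem (m : ℕ) : blockPt m ∈ blockRegion m := by
  rcases block_cases m with rfl | rfl | rfl | rfl | ⟨k, rfl | rfl | rfl | rfl⟩
  · simp [blockRegion]
  · simp [blockRegion, blockPt]
  · simp [blockRegion, blockPt]
  · simp [blockRegion, blockPt]
  · rw [blockRegion_four_mul, mem_preimage, rescale_blockPt_zero]
    norm_num [chevron]
  · rw [blockRegion_add_one, mem_preimage, rescale_blockPt_add_one]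
    norm_num [chevron]
  · rw [blockRegion_add_two, mem_preimage, rescale_blockPt_add_two]
    norm_num [chevron, abs_of_pos]
  · rw [blockRegion_add_three, mem_preimage, rescale_blockPt_add_three]
    norm_num [chevron, halfKite]

theorem blockRegion_succ_subset (m : ℕ) : blockRegion (m + 1) ⊆ blockRegion m := by
  intro z hz
  rcases block_cases m with rfl | rfl | rfl | rfl | ⟨k, rfl | rfl | rfl | rfl⟩
  · simp [blockRegion]
  · simp only [blockRegion] at hz ⊢
    norm_num at hz ⊢
    rintro rfl
    norm_num at hz
  · simp only [blockRegion, chevron] at hz ⊢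
    norm_num at hz ⊢
    intro h1 h2
    by_contra! h3
    rw [abs_of_nonpos h3] at hz
    rcases hz with hz | ⟨-, hz⟩ <;> linarith
  · rw [show 3 + 1 = 4 * (0 + 1) by norm_num, blockRegion_next] at hz
    simp only [blockRegion]
    norm_num
    right
    simpa [rescale] using hz
  all_goals
    first
    | rw [blockRegion_add_one] at hz; rw [blockRegion_four_mul]
    | rw [show 4 * (k + 1) + 1 + 1 = 4 * (k + 1) + 2 by ring, blockRegion_add_two] at hz
      rw [blockRegion_add_one]
    | rw [show 4 * (k + 1) + 2 + 1 = 4 * (k + 1) + 3 by ring, blockRegion_add_three] at hz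
      rw [blockRegion_add_two]
    | rw [show 4 * (k + 1) + 3 + 1 = 4 * (k + 1 + 1) by ring, blockRegion_next] at hz
      rw [blockRegion_add_three]
    simp only [mem_preimage, mem_union, chevron, halfKite, mem_ofPred_eq] at hz ⊢
    generalize rescale (k + 1) z = w at hz ⊢
  · rcases abs_cases w.1 with ⟨h, h'⟩ | ⟨h, h'⟩ <;> rw [h] at hz ⊢ <;>
      rcases hz with ⟨h1, h2⟩ | ⟨h1, h2⟩ <;> constructor <;> linarith
  · refine hz.imp id fun ⟨h1, h2⟩ => ⟨h1, ?_⟩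
    rcases abs_cases w.1 with ⟨h, h'⟩ | ⟨h, h'⟩ <;> rw [h] at h1 h2 ⊢ <;> linarith
  · refine hz.imp id fun ⟨h1, h2⟩ => ?_
    rcases le_total w.1 0 with h | h
    · rw [abs_of_nonpos h]
      have := h1 h
      constructor <;> linarith
    · rw [abs_of_nonneg h]
      have := h2 h
      constructor <;> linarith
  · exact Or.inl hz

theorem blockPt_notMem (m : ℕ) : blockPt m ∉ blockRegion (m + 1) := by
  rcases block_cases m with rfl | rfl | rfl | rfl | ⟨k, rfl | rfl | rfl | rfl⟩
  · simp [blockRegion, blockPt]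
  · norm_num [blockRegion, blockPt]
  · norm_num [blockRegion, blockPt, chevron]
  · rw [show 3 + 1 = 4 * (0 + 1) by norm_num, blockRegion_next]
    norm_num [blockPt, chevron, rescale]
  · rw [blockRegion_add_one, mem_preimage, rescale_blockPt_zero]
    norm_num [chevron]
  · rw [show 4 * (k + 1) + 1 + 1 = 4 * (k + 1) + 2 by ring, blockRegion_add_two, mem_preimage,
      rescale_blockPt_add_one]
    norm_num [chevron]
  · rw [show 4 * (k + 1) + 2 + 1 = 4 * (k + 1) + 3 by ring, blockRegion_add_three, mem_preimage,
      rescale_blockPt_add_two]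
    norm_num [chevron, halfKite, abs_of_pos]
  · rw [show 4 * (k + 1) + 3 + 1 = 4 * (k + 1 + 1) by ring, blockRegion_next, mem_preimage,
      rescale_blockPt_add_three]
    norm_num [chevron, abs_of_pos]

theorem blockSegment_subset (m : ℕ) : ∀ i ∈ blockNb m,
    ∀ z ∈ segment ℝ (blockPt m) (blockPt i), z ≠ blockPt i → z ∈ blockRegion m := by
  intro i hi z hz hne
  rcases block_cases m with rfl | rfl | rfl | rfl | ⟨k, rfl | rfl | rfl | rfl⟩
  · simp [blockRegion]
  · obtain rfl : i = 0 := by simpa [blockNb] using hi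
    simpa [blockRegion, blockPt] using hne
  · obtain ⟨u, v, hu, hv, huv, hpos, h1, h2⟩ := exists_of_mem_segment 0 hz
    replace hpos := hpos hne
    have hi : i = 0 ∨ i = 1 := by simpa [blockNb] using hi
    rcases hi with rfl | rfl <;> norm_num [rescale, blockPt, blockRegion] at h1 h2 ⊢ <;>
      intro h3 h4 <;> linarith
  · obtain ⟨u, v, hu, hv, huv, hpos, h1, h2⟩ := exists_of_mem_segment 0 hz
    replace hpos := hpos hne
    have hi : i = 1 ∨ i = 2 := by simpa [blockNb] using hi
    rcases hi with rfl | rfl <;> norm_num [rescale, blockPt, blockRegion] at h1 h2 ⊢ <;>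
      left <;> rcases abs_cases z.1 with ⟨h, h'⟩ | ⟨h, h'⟩ <;> linarith
  · obtain ⟨u, v, hu, hv, huv, hpos, h1, h2⟩ := exists_of_mem_segment (k + 1) hz
    replace hpos := hpos hne
    rw [blockRegion_four_mul]
    have hi : i = 1 ∨ i = 2 := by simpa [blockNb_four_mul] using hi
    rw [rescale_blockPt_zero] at h1 h2
    simp only [mem_preimage, chevron, mem_ofPred_eq]
    rcases hi with rfl | rfl <;>
      simp only [rescale_blockPt_one, rescale_blockPt_two] at h1 h2 <;>
      rcases abs_cases (rescale (k + 1) z).1 with ⟨h, h'⟩ | ⟨h, h'⟩ <;> constructor <;> linarith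
  · obtain ⟨u, v, hu, hv, huv, hpos, h1, h2⟩ := exists_of_mem_segment (k + 1) hz
    replace hpos := hpos hne
    rw [blockRegion_add_one]
    have hi : i = 1 ∨ i = 2 ∨ i = 4 * k := by simpa [blockNb_add_one] using hi
    rw [rescale_blockPt_add_one] at h1 h2
    simp only [mem_preimage, chevron, mem_union, mem_ofPred_eq]
    rcases hi with rfl | rfl | rfl <;>
      simp only [rescale_blockPt_one, rescale_blockPt_two, rescale_blockPt_prev] at h1 h2 <;>
      right <;>
      rcases abs_cases (rescale (k + 1) z).1 with ⟨h, h'⟩ | ⟨h, h'⟩ <;> constructor <;> linarith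
  · obtain ⟨u, v, hu, hv, huv, hpos, h1, h2⟩ := exists_of_mem_segment (k + 1) hz
    replace hpos := hpos hne
    rw [blockRegion_add_two]
    have hi : i = 1 ∨ i = 4 * (k + 1) ∨ i = 4 * (k + 1) + 1 := by
      simpa [blockNb_add_two] using hi
    rw [rescale_blockPt_add_two] at h1 h2
    simp only [mem_preimage, chevron, mem_union, mem_ofPred_eq]
    rcases hi with rfl | rfl | rfl <;>
      simp only [rescale_blockPt_one, rescale_blockPt_zero, rescale_blockPt_add_one] at h1 h2 <;>
      right <;>
      rcases abs_cases (rescale (k + 1) z).1 with ⟨h, h'⟩ | ⟨h, h'⟩ <;> constructor <;> linarith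
  · obtain ⟨u, v, hu, hv, huv, hpos, h1, h2⟩ := exists_of_mem_segment (k + 1) hz
    replace hpos := hpos hne
    rw [blockRegion_add_three]
    have hi : i = 2 ∨ i = 4 * (k + 1) ∨ i = 4 * (k + 1) + 1 := by
      simpa [blockNb_add_three] using hi
    rw [rescale_blockPt_add_three] at h1 h2
    simp only [mem_preimage, halfKite, mem_union, mem_ofPred_eq]
    rcases hi with rfl | rfl | rfl <;>
      simp only [rescale_blockPt_two, rescale_blockPt_zero, rescale_blockPt_add_one] at h1 h2 <;>
      refine Or.inr ⟨fun h => ?_, fun h => ⟨?_, ?_⟩⟩ <;> linarith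

theorem blockSegment_disjoint (m : ℕ) : ∀ i ∈ blockNb m,
    ∀ z ∈ segment ℝ (blockPt m) (blockPt i), z ∉ blockRegion (m + 1) := by
  intro i hi z hz hmem
  rcases block_cases m with rfl | rfl | rfl | rfl | ⟨k, rfl | rfl | rfl | rfl⟩
  · simp [blockNb] at hi
  · obtain ⟨u, v, hu, hv, huv, -, h1, h2⟩ := exists_of_mem_segment 0 hz
    obtain rfl : i = 0 := by simpa [blockNb] using hi
    norm_num [rescale, blockPt, blockRegion] at h1 h2 hmem
    linarith [hmem (by linarith) (by linarith)]
  · obtain ⟨u, v, hu, hv, huv, -, h1, h2⟩ := exists_of_mem_segment 0 hz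
    have hi : i = 0 ∨ i = 1 := by simpa [blockNb] using hi
    rcases hi with rfl | rfl <;> norm_num [rescale, blockPt, blockRegion, chevron] at h1 h2 hmem <;>
      rcases hmem with hmem | ⟨h3, h4⟩ <;> rcases abs_cases z.1 with ⟨h, h'⟩ | ⟨h, h'⟩ <;> linarith
  · obtain ⟨u, v, hu, hv, huv, -, h1, h2⟩ := exists_of_mem_segment 0 hz
    have hi : i = 1 ∨ i = 2 := by simpa [blockNb] using hi
    rw [show 3 + 1 = 4 * (0 + 1) by norm_num, blockRegion_next] at hmem
    obtain ⟨h3, h4⟩ := hmem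
    rcases hi with rfl | rfl <;> norm_num [rescale, blockPt] at h1 h2 h3 h4 <;>
      rcases abs_cases z.1 with ⟨h, h'⟩ | ⟨h, h'⟩ <;> linarith
  · obtain ⟨u, v, hu, hv, huv, -, h1, h2⟩ := exists_of_mem_segment (k + 1) hz
    rw [blockRegion_add_one] at hmem
    have hi : i = 1 ∨ i = 2 := by simpa [blockNb_four_mul] using hi
    rw [rescale_blockPt_zero] at h1 h2
    rcases hi with rfl | rfl <;>
      simp only [rescale_blockPt_one, rescale_blockPt_two] at h1 h2 <;>
      rcases hmem with ⟨h3, h4⟩ | ⟨h3, h4⟩ <;>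
      rcases abs_cases (rescale (k + 1) z).1 with ⟨h, h'⟩ | ⟨h, h'⟩ <;> linarith
  · obtain ⟨u, v, hu, hv, huv, -, h1, h2⟩ := exists_of_mem_segment (k + 1) hz
    rw [show 4 * (k + 1) + 1 + 1 = 4 * (k + 1) + 2 by ring, blockRegion_add_two] at hmem
    have hi : i = 1 ∨ i = 2 ∨ i = 4 * k := by simpa [blockNb_add_one] using hi
    rw [rescale_blockPt_add_one] at h1 h2
    rcases hi with rfl | rfl | rfl <;>
      simp only [rescale_blockPt_one, rescale_blockPt_two, rescale_blockPt_prev] at h1 h2 <;>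
      rcases hmem with ⟨h3, h4⟩ | ⟨h3, h4⟩ <;>
      rcases abs_cases (rescale (k + 1) z).1 with ⟨h, h'⟩ | ⟨h, h'⟩ <;> linarith
  · obtain ⟨u, v, hu, hv, huv, -, h1, h2⟩ := exists_of_mem_segment (k + 1) hz
    rw [show 4 * (k + 1) + 2 + 1 = 4 * (k + 1) + 3 by ring, blockRegion_add_three] at hmem
    have hi : i = 1 ∨ i = 4 * (k + 1) ∨ i = 4 * (k + 1) + 1 := by
      simpa [blockNb_add_two] using hi
    rw [rescale_blockPt_add_two] at h1 h2
    rcases hi with rfl | rfl | rfl <;>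
      simp only [rescale_blockPt_one, rescale_blockPt_zero, rescale_blockPt_add_one] at h1 h2 <;>
      rcases hmem with ⟨h3, h4⟩ | ⟨h3, -⟩ <;>
      first
      | rcases abs_cases (rescale (k + 1) z).1 with ⟨h, h'⟩ | ⟨h, h'⟩ <;> linarith
      | obtain ⟨h3, h4⟩ := h3 (by linarith); linarith
  · obtain ⟨u, v, hu, hv, huv, -, h1, h2⟩ := exists_of_mem_segment (k + 1) hz
    rw [show 4 * (k + 1) + 3 + 1 = 4 * (k + 1 + 1) by ring, blockRegion_next] at hmem
    have hi : i = 2 ∨ i = 4 * (k + 1) ∨ i = 4 * (k + 1) + 1 := by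
      simpa [blockNb_add_three] using hi
    rw [rescale_blockPt_add_three] at h1 h2
    obtain ⟨h3, h4⟩ := hmem
    rcases hi with rfl | rfl | rfl <;>
      simp only [rescale_blockPt_two, rescale_blockPt_zero, rescale_blockPt_add_one] at h1 h2 <;>
      rcases abs_cases (rescale (k + 1) z).1 with ⟨h, h'⟩ | ⟨h, h'⟩ <;> linarith

theorem blockSegment_inter (m : ℕ) : ∀ i ∈ blockNb m, ∀ j ∈ blockNb m, i ≠ j →
    ∀ z ∈ segment ℝ (blockPt m) (blockPt i), z ∈ segment ℝ (blockPt m) (blockPt j) →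
      z = blockPt m := by
  intro i hi j hj hij z hz hz'
  rcases block_cases m with rfl | rfl | rfl | rfl | ⟨k, rfl | rfl | rfl | rfl⟩
  · simp [blockNb] at hi
  · simp [blockNb] at hi hj
    omega
  · obtain ⟨u, v, hu, hv, huv, -, h1, h2⟩ := exists_of_mem_segment 0 hz
    obtain ⟨u', v', hu', hv', huv', -, h1', h2'⟩ := exists_of_mem_segment 0 hz'
    have hi : i = 0 ∨ i = 1 := by simpa [blockNb] using hi
    have hj : j = 0 ∨ j = 1 := by simpa [blockNb] using hj
    apply rescale_injective 0
    rcases hi with rfl | rfl <;> rcases hj with rfl | rfl <;>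
      first
      | exact absurd rfl hij
      | norm_num [rescale, blockPt] at h1 h2 h1' h2' ⊢
        exact Prod.ext (by simp; linarith) (by simp; linarith)
  · obtain ⟨u, v, hu, hv, huv, -, h1, h2⟩ := exists_of_mem_segment 0 hz
    obtain ⟨u', v', hu', hv', huv', -, h1', h2'⟩ := exists_of_mem_segment 0 hz'
    have hi : i = 1 ∨ i = 2 := by simpa [blockNb] using hi
    have hj : j = 1 ∨ j = 2 := by simpa [blockNb] using hj
    apply rescale_injective 0
    rcases hi with rfl | rfl <;> rcases hj with rfl | rfl <;>
      first
      | exact absurd rfl hij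
      | norm_num [rescale, blockPt] at h1 h2 h1' h2' ⊢
        exact Prod.ext (by simp; linarith) (by simp; linarith)
  · obtain ⟨u, v, hu, hv, huv, -, h1, h2⟩ := exists_of_mem_segment (k + 1) hz
    obtain ⟨u', v', hu', hv', huv', -, h1', h2'⟩ := exists_of_mem_segment (k + 1) hz'
    rw [blockNb_four_mul] at hi hj
    simp only [Finset.mem_insert, Finset.mem_singleton] at hi hj
    apply rescale_injective (k + 1)
    rw [rescale_blockPt_zero] at h1 h2 h1' h2' ⊢
    rcases hi with rfl | rfl <;> rcases hj with rfl | rfl <;>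
      first
      | exact absurd rfl hij
      | simp only [rescale_blockPt_one, rescale_blockPt_two] at h1 h2 h1' h2'
        exact Prod.ext (by simp only; linarith) (by simp only; linarith)
  · obtain ⟨u, v, hu, hv, huv, -, h1, h2⟩ := exists_of_mem_segment (k + 1) hz
    obtain ⟨u', v', hu', hv', huv', -, h1', h2'⟩ := exists_of_mem_segment (k + 1) hz'
    rw [blockNb_add_one] at hi hj
    simp only [Finset.mem_insert, Finset.mem_singleton] at hi hj
    apply rescale_injective (k + 1)
    rw [rescale_blockPt_add_one] at h1 h2 h1' h2' ⊢
    rcases hi with rfl | rfl | rfl <;> rcases hj with rfl | rfl | rfl <;>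
      first
      | exact absurd rfl hij
      | simp only [rescale_blockPt_one, rescale_blockPt_two, rescale_blockPt_prev]
          at h1 h2 h1' h2'
        exact Prod.ext (by simp only; linarith) (by simp only; linarith)
  · obtain ⟨u, v, hu, hv, huv, -, h1, h2⟩ := exists_of_mem_segment (k + 1) hz
    obtain ⟨u', v', hu', hv', huv', -, h1', h2'⟩ := exists_of_mem_segment (k + 1) hz'
    rw [blockNb_add_two] at hi hj
    simp only [Finset.mem_insert, Finset.mem_singleton] at hi hj
    apply rescale_injective (k + 1)
    rw [rescale_blockPt_add_two] at h1 h2 h1' h2' ⊢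
    rcases hi with rfl | rfl | rfl <;> rcases hj with rfl | rfl | rfl <;>
      first
      | exact absurd rfl hij
      | simp only [rescale_blockPt_one, rescale_blockPt_zero, rescale_blockPt_add_one]
          at h1 h2 h1' h2'
        exact Prod.ext (by simp only; linarith) (by simp only; linarith)
  · obtain ⟨u, v, hu, hv, huv, -, h1, h2⟩ := exists_of_mem_segment (k + 1) hz
    obtain ⟨u', v', hu', hv', huv', -, h1', h2'⟩ := exists_of_mem_segment (k + 1) hz'
    rw [blockNb_add_three] at hi hj
    simp only [Finset.mem_insert, Finset.mem_singleton] at hi hj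
    apply rescale_injective (k + 1)
    rw [rescale_blockPt_add_three] at h1 h2 h1' h2' ⊢
    rcases hi with rfl | rfl | rfl <;> rcases hj with rfl | rfl | rfl <;>
      first
      | exact absurd rfl hij
      | simp only [rescale_blockPt_two, rescale_blockPt_zero, rescale_blockPt_add_one]
          at h1 h2 h1' h2'
        exact Prod.ext (by simp only; linarith) (by simp only; linarith)

/-- The drawing of the extremal graphs. -/
noncomputable def blockDrawing : IncrementalDrawing where
  pt := blockPt
  nb := blockNb
  region := blockRegion
  nb_lt := blockNb_lt
  pt_mem := blockPt_mem
  segment_subset := blockSegment_subset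
  region_succ_subset := blockRegion_succ_subset
  pt_notMem := blockPt_notMem
  segment_disjoint := blockSegment_disjoint
  segment_inter := blockSegment_inter

/-! ### Faces and edges of the extremal drawing -/

namespace IncrementalDrawing

variable (I : IncrementalDrawing)

theorem disjoint_covered_of_disjoint_region {m : ℕ} (n : ℕ) {X : Set (ℝ × ℝ)}
    (h : Disjoint (I.covered m) X) (h' : Disjoint (I.region m) X) : Disjoint (I.covered n) X :=
  (h.union_left h').mono_left (I.covered_subset m n)

theorem disjoint_covered_succ {m : ℕ} {X : Set (ℝ × ℝ)} (h : X ⊆ I.region m)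
    (hpt : I.pt m ∉ X) (hseg : ∀ i ∈ I.nb m, ∀ z ∈ segment ℝ (I.pt m) (I.pt i), z ∉ X) :
    Disjoint (I.covered (m + 1)) X := by
  rw [Set.disjoint_left]
  rintro z ⟨j, hj, hz⟩ hzX
  rcases Nat.lt_succ_iff_lt_or_eq.1 hj with hj | rfl
  · exact Set.disjoint_left.1 (I.disjoint_covered_region m) ⟨j, hj, hz⟩ (h hzX)
  · rcases hz with rfl | ⟨i, hi, hz⟩
    · exact hpt hzX
    · exact hseg i hi z hz hzX

end IncrementalDrawing

/-- The point from which the quadrilateral faces of the `k`-th block are seen. -/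
noncomputable def blockCenter (k : ℕ) (y : ℝ) : ℝ × ℝ := (0, y * (1 / 4) ^ k)

theorem rescale_blockCenter (k : ℕ) (y : ℝ) : rescale k (blockCenter k y) = (0, y) := by
  rw [blockCenter, rescale, mul_left_comm, pow_mul_inv_pow, mul_one]

/-- A vertex of the drawing that lies on a quadrilateral `P A Q B` whose sides are all seen from a
point off the drawing is on the boundary of a face of length at least `4`. -/
theorem exists_face_of_fans {n : ℕ} (v : Fin n) {P Q A B : ℕ} (hP : P < n) (hQ : Q < n)
    (hA : A < n) (hB : B < n) (hv : (v : ℕ) = P ∨ (v : ℕ) = Q ∨ (v : ℕ) = A ∨ (v : ℕ) = B)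
    (hPQ : P ≠ Q) (hAB : A ≠ B) (hPB : P ≠ B) (hQB : Q ≠ B)
    (hPA : P ∈ blockNb A ∨ A ∈ blockNb P) (hPB' : P ∈ blockNb B ∨ B ∈ blockNb P)
    (hQA : Q ∈ blockNb A ∨ A ∈ blockNb Q) (hQB' : Q ∈ blockNb B ∨ B ∈ blockNb Q)
    {c : ℝ × ℝ} {X : Set (ℝ × ℝ)} (hX : Disjoint (blockDrawing.covered n) X)
    (h1 : fan c (blockPt P) (blockPt A) ⊆ X) (h2 : fan c (blockPt P) (blockPt B) ⊆ X)
    (h3 : fan c (blockPt Q) (blockPt A) ⊆ X) (h4 : fan c (blockPt Q) (blockPt B) ⊆ X) :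
    ∃ F, (blockDrawing.drawing n).IsFace F ∧ (blockDrawing.drawing n).point v ∈ frontier F ∧
      4 ≤ (blockDrawing.drawing n).faceLength F := by
  obtain ⟨F, hF, hlen, hfr⟩ := blockDrawing.exists_face (P := ⟨P, hP⟩) (Q := ⟨Q, hQ⟩)
    (A := ⟨A, hA⟩) (B := ⟨B, hB⟩) (by simpa using hPQ) (by simpa using hAB) (by simpa using hPB)
    (by simpa using hQB) hPA hPB' hQA hQB' hX h1 h2 h3 h4
  refine ⟨F, hF, hfr v ?_, hlen⟩
  simpa only [mem_insert_iff, mem_singleton_iff, Fin.ext_iff] using hv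

/-- The quadrilateral `0, 1, 3, 2` stays empty. -/
theorem disjoint_covered_chevron (n : ℕ) :
    Disjoint (blockDrawing.covered n) (rescale 0 ⁻¹' chevron 1 2) := by
  refine blockDrawing.disjoint_covered_of_disjoint_region (m := 3 + 1) n
    (blockDrawing.disjoint_covered_succ ?_ ?_ ?_) ?_
  · rintro z ⟨h1, h2⟩
    change z ∈ blockRegion 3
    norm_num [blockRegion, rescale] at h1 ⊢
    exact Or.inl h1
  · change blockPt 3 ∉ _
    norm_num [blockPt, rescale, chevron]
  · intro i hi z hz hmem
    change i ∈ blockNb 3 at hi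
    change z ∈ segment ℝ (blockPt 3) (blockPt i) at hz
    obtain ⟨u, v, hu, hv, huv, -, h1, h2⟩ := exists_of_mem_segment 0 hz
    have hi : i = 1 ∨ i = 2 := by simpa [blockNb] using hi
    obtain ⟨h3, h4⟩ := hmem
    rcases hi with rfl | rfl <;> norm_num [rescale, blockPt] at h1 h2 h3 h4 <;>
      rcases abs_cases z.1 with ⟨h, h'⟩ | ⟨h, h'⟩ <;> linarith
  · change Disjoint (blockRegion (4 * (0 + 1))) _
    rw [blockRegion_next, Set.disjoint_left]
    rintro z ⟨h1, h2⟩ ⟨h3, h4⟩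
    linarith

/-- The quadrilateral that a block leaves behind stays empty. -/
theorem disjoint_covered_kite (k n : ℕ) :
    Disjoint (blockDrawing.covered n) (rescale (k + 1) ⁻¹' kite) := by
  refine blockDrawing.disjoint_covered_of_disjoint_region (m := 4 * (k + 1) + 3 + 1) n
    (blockDrawing.disjoint_covered_succ ?_ ?_ ?_) ?_
  · rintro z ⟨h1, h2⟩
    change z ∈ blockRegion (4 * (k + 1) + 3)
    rw [blockRegion_add_three]
    refine Or.inr ⟨fun h => ⟨h1, ?_⟩, fun h => ?_⟩
    · rw [abs_of_nonpos h] at h2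
      linarith
    · rw [abs_of_nonneg h] at h2
      constructor <;> linarith
  · change blockPt (4 * (k + 1) + 3) ∉ _
    rw [mem_preimage, rescale_blockPt_add_three]
    norm_num [kite]
  · intro i hi z hz hmem
    change i ∈ blockNb _ at hi
    change z ∈ segment ℝ (blockPt _) (blockPt i) at hz
    obtain ⟨u, v, hu, hv, huv, -, h1, h2⟩ := exists_of_mem_segment (k + 1) hz
    have hi : i = 2 ∨ i = 4 * (k + 1) ∨ i = 4 * (k + 1) + 1 := by
      simpa [blockNb_add_three] using hi
    rw [rescale_blockPt_add_three] at h1 h2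
    obtain ⟨h3, h4⟩ := hmem
    rcases hi with rfl | rfl | rfl <;>
      simp only [rescale_blockPt_two, rescale_blockPt_zero, rescale_blockPt_add_one] at h1 h2 <;>
      rcases abs_cases (rescale (k + 1) z).1 with ⟨h, h'⟩ | ⟨h, h'⟩ <;> linarith
  · change Disjoint (blockRegion (4 * (k + 1 + 1))) _
    rw [blockRegion_next, Set.disjoint_left]
    rintro z ⟨h1, h2⟩ ⟨h3, h4⟩
    linarith [abs_nonneg (rescale (k + 1) z).1]

theorem disjoint_covered_of_subset_region {n : ℕ} {X : Set (ℝ × ℝ)} (h : X ⊆ blockRegion n) :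
    Disjoint (blockDrawing.covered n) X :=
  (blockDrawing.disjoint_covered_region n).mono_right h

/-- The fans that make up the quadrilaterals between two chevrons. -/
theorem fan_subset_chevron {k : ℕ} {c P A : ℝ × ℝ} {y p b x : ℝ} (hc : rescale k c = (0, y))
    (hP : rescale k P = (0, p)) (hA : rescale k A = (x, 0)) (hx : |x| = 1) (hp : 1 ≤ p)
    (hpb : p ≤ b) (hy : 1 < y) (hyb : y < b) : fan c P A ⊆ rescale k ⁻¹' chevron 1 b := by
  intro z hz
  obtain ⟨t, u, v, ht, hu, hv, h, h1, h2⟩ := exists_of_mem_fan k hz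
  rw [hc, hP, hA] at h1 h2
  simp only [mul_zero, zero_add, add_zero] at h1 h2
  have habs : |(rescale k z).1| = v := by rw [h1, abs_mul, hx, abs_of_nonneg hv, mul_one]
  refine ⟨?_, ?_⟩
  · rw [habs, h2]
    nlinarith [mul_lt_mul_of_pos_left hy ht, mul_le_mul_of_nonneg_left hp hu]
  · rw [habs, h2, show 1 - v = t + u by linarith]
    nlinarith [mul_lt_mul_of_pos_left hyb ht, mul_le_mul_of_nonneg_left hpb hu]

/-- A vertex of a complete block lies on the kite of this block. In an incomplete last block, the
vertices lie on the quadrilateral that is still open. -/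
theorem everyVertexBounds_blockDrawing {n : ℕ} (hn : 4 ≤ n) :
    (blockDrawing.drawing n).EveryVertexBounds 4 := by
  intro v
  have hvn := v.2
  have habs : |(-1 : ℝ)| = 1 := by norm_num
  by_cases hv4 : (v : ℕ) < 4
  · have hc := rescale_blockCenter 0 (3 / 2)
    have hP : rescale 0 (blockPt 0) = (0, 1) := rescale_blockPt_zero 0
    have hQ : rescale 0 (blockPt 3) = (0, 2) := by norm_num [rescale, blockPt]
    have hA := rescale_blockPt_one 0
    have hB := rescale_blockPt_two 0
    refine exists_face_of_fans v (P := 0) (Q := 3) (A := 1) (B := 2) (by omega) (by omega)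
      (by omega) (by omega) (by omega) (by omega) (by omega) (by omega) (by omega)
      (by decide) (by decide) (by decide) (by decide) (disjoint_covered_chevron n)
      (fan_subset_chevron hc hP hA habs ?_ ?_ ?_ ?_)
      (fan_subset_chevron hc hP hB abs_one ?_ ?_ ?_ ?_)
      (fan_subset_chevron hc hQ hA habs ?_ ?_ ?_ ?_)
      (fan_subset_chevron hc hQ hB abs_one ?_ ?_ ?_ ?_) <;> norm_num
  obtain ⟨k, hk⟩ : ∃ k, (v : ℕ) = 4 * (k + 1) ∨ (v : ℕ) = 4 * (k + 1) + 1 ∨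
      (v : ℕ) = 4 * (k + 1) + 2 ∨ (v : ℕ) = 4 * (k + 1) + 3 := by
    rcases block_cases v with h | h | h | h | h
    · omega
    · omega
    · omega
    · omega
    · exact h
  have hP := rescale_blockPt_zero (k + 1)
  have hA := rescale_blockPt_one (k + 1)
  have hB := rescale_blockPt_two (k + 1)
  -- whether the block of `v` is complete, and else how many of its vertices are there
  obtain hlast | hlast | hlast | hlast : n = 4 * (k + 1) + 1 ∨ n = 4 * (k + 1) + 2 ∨
      n = 4 * (k + 1) + 3 ∨ 4 * (k + 1) + 4 ≤ n := by omega
  · have hc := rescale_blockCenter (k + 1) 2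
    have hQ := rescale_blockPt_prev k
    have hQ1 : 1 ∈ blockNb (4 * k) ∨ 4 * k ∈ blockNb 1 := by
      cases k with
      | zero => right; decide
      | succ k => left; simp [blockNb_four_mul]
    have hQ2 : 2 ∈ blockNb (4 * k) ∨ 4 * k ∈ blockNb 2 := by
      cases k with
      | zero => right; decide
      | succ k => left; simp [blockNb_four_mul]
    refine exists_face_of_fans v (P := 4 * (k + 1)) (Q := 4 * k) (A := 1) (B := 2) (by omega)
      (by omega) (by omega) (by omega) (by omega) (by omega) (by omega) (by omega) (by omega)
      (Or.inr (by simp [blockNb_four_mul])) (Or.inr (by simp [blockNb_four_mul])) hQ1.symm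
      hQ2.symm (disjoint_covered_of_subset_region
        (X := rescale (k + 1) ⁻¹' chevron 1 4) ?_)
      (fan_subset_chevron hc hP hA habs ?_ ?_ ?_ ?_)
      (fan_subset_chevron hc hP hB abs_one ?_ ?_ ?_ ?_)
      (fan_subset_chevron hc hQ hA habs ?_ ?_ ?_ ?_)
      (fan_subset_chevron hc hQ hB abs_one ?_ ?_ ?_ ?_)
    · rw [hlast, blockRegion_add_one]
      exact preimage_mono subset_union_right
    all_goals norm_num
  · have hc := rescale_blockCenter (k + 1) (3 / 2)
    have hQ := rescale_blockPt_add_one k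
    refine exists_face_of_fans v (P := 4 * (k + 1)) (Q := 4 * (k + 1) + 1) (A := 1) (B := 2)
      (by omega) (by omega) (by omega) (by omega) (by omega) (by omega) (by omega) (by omega)
      (by omega) (Or.inr (by simp [blockNb_four_mul])) (Or.inr (by simp [blockNb_four_mul]))
      (Or.inr (by simp [blockNb_add_one])) (Or.inr (by simp [blockNb_add_one]))
      (disjoint_covered_of_subset_region (X := rescale (k + 1) ⁻¹' chevron 1 2) ?_)
      (fan_subset_chevron hc hP hA habs ?_ ?_ ?_ ?_)
      (fan_subset_chevron hc hP hB abs_one ?_ ?_ ?_ ?_)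
      (fan_subset_chevron hc hQ hA habs ?_ ?_ ?_ ?_)
      (fan_subset_chevron hc hQ hB abs_one ?_ ?_ ?_ ?_)
    · rw [hlast, blockRegion_add_two]
      exact preimage_mono subset_union_right
    all_goals norm_num
  · have hc := rescale_blockCenter (k + 1) (3 / 2)
    have hQ := rescale_blockPt_add_one k
    have hA' := rescale_blockPt_add_two k
    refine exists_face_of_fans v (P := 4 * (k + 1)) (Q := 4 * (k + 1) + 1) (A := 4 * (k + 1) + 2)
      (B := 2) (c := blockCenter (k + 1) (3 / 2)) (by omega) (by omega) (by omega) (by omega)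
      (by omega) (by omega) (by omega) (by omega) (by omega)
      (Or.inl (by simp [blockNb_add_two])) (Or.inr (by simp [blockNb_four_mul]))
      (Or.inl (by simp [blockNb_add_two])) (Or.inr (by simp [blockNb_add_one]))
      (disjoint_covered_of_subset_region (X := rescale (k + 1) ⁻¹' halfKite) ?_) ?_ ?_ ?_ ?_
    · rw [hlast, blockRegion_add_three]
      exact preimage_mono subset_union_right
    all_goals
      intro z hz
      obtain ⟨t, u, w, ht, hu, hw, h, h1, h2⟩ := exists_of_mem_fan (k + 1) hz
      simp only [hc, hP, hQ, hA', hB] at h1 h2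
      exact ⟨fun h0 => ⟨by linarith, by linarith⟩, fun h0 => ⟨by linarith, by linarith⟩⟩
  · have hc := rescale_blockCenter (k + 1) (3 / 2)
    have hQ := rescale_blockPt_add_one k
    have hA' := rescale_blockPt_add_two k
    have hB' := rescale_blockPt_add_three k
    refine exists_face_of_fans v (P := 4 * (k + 1)) (Q := 4 * (k + 1) + 1) (A := 4 * (k + 1) + 2)
      (B := 4 * (k + 1) + 3) (c := blockCenter (k + 1) (3 / 2)) (by omega) (by omega) (by omega)
      (by omega) (by omega) (by omega) (by omega) (by omega) (by omega)
      (Or.inl (by simp [blockNb_add_two])) (Or.inl (by simp [blockNb_add_three]))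
      (Or.inl (by simp [blockNb_add_two])) (Or.inl (by simp [blockNb_add_three]))
      (disjoint_covered_kite k n) ?_ ?_ ?_ ?_
    all_goals
      intro z hz
      obtain ⟨t, u, w, ht, hu, hw, h, h1, h2⟩ := exists_of_mem_fan (k + 1) hz
      simp only [hc, hP, hQ, hA', hB'] at h1 h2
      refine ⟨by linarith, ?_⟩
      rcases abs_cases (rescale (k + 1) z).1 with ⟨h0, h0'⟩ | ⟨h0, h0'⟩ <;> linarith

theorem card_blockNb_four_mul (k : ℕ) : (blockNb (4 * (k + 1))).card = 2 := by
  rw [blockNb_four_mul]; rfl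

theorem card_blockNb_add_one (k : ℕ) : (blockNb (4 * (k + 1) + 1)).card = 3 := by
  rw [blockNb_add_one]
  exact Finset.card_eq_three.2 ⟨_, _, _, by omega, by omega, by omega, rfl⟩

theorem card_blockNb_add_two (k : ℕ) : (blockNb (4 * (k + 1) + 2)).card = 3 := by
  rw [blockNb_add_two]
  exact Finset.card_eq_three.2 ⟨_, _, _, by omega, by omega, by omega, rfl⟩

theorem card_blockNb_add_three (k : ℕ) : (blockNb (4 * (k + 1) + 3)).card = 3 := by
  rw [blockNb_add_three]
  exact Finset.card_eq_three.2 ⟨_, _, _, by omega, by omega, by omega, rfl⟩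

theorem sum_card_blockNb (k : ℕ) :
    ∑ j ∈ Finset.range (4 * (k + 1)), (blockNb j).card = 11 * k + 5 := by
  induction k with
  | zero => decide
  | succ k ih =>
    rw [show 4 * (k + 1 + 1) = 4 * (k + 1) + 1 + 1 + 1 + 1 by ring, Finset.sum_range_succ,
      Finset.sum_range_succ, Finset.sum_range_succ, Finset.sum_range_succ, ih,
      card_blockNb_four_mul, card_blockNb_add_one, card_blockNb_add_two, card_blockNb_add_three]
    ring

theorem ncard_edgeSet_blockDrawing {n : ℕ} (hn : 4 ≤ n) :
    (((blockDrawing.graph n).edgeSet.ncard : ℕ) : ℤ) = (11 * n - 24) / 4 := by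
  rw [IncrementalDrawing.ncard_edgeSet_graph]
  change ((∑ j ∈ Finset.range n, (blockNb j).card : ℕ) : ℤ) = _
  obtain ⟨k, hk⟩ : ∃ k, n = 4 * (k + 1) ∨ n = 4 * (k + 1) + 1 ∨
      n = 4 * (k + 1) + 2 ∨ n = 4 * (k + 1) + 3 := by
    rcases block_cases n with h | h | h | h | h
    · omega
    · omega
    · omega
    · omega
    · exact h
  have hsum := sum_card_blockNb k
  rcases hk with rfl | rfl | rfl | rfl <;> simp only [Finset.sum_range_succ, hsum,
    card_blockNb_four_mul, card_blockNb_add_one, card_blockNb_add_two] <;>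
    omega

theorem floor_edge_bound (n : ℕ) :
    ⌊(11 / 4 : ℝ) * (n : ℝ) - 6⌋ = (11 * (n : ℤ) - 24) / 4 := by
  have h : (11 / 4 : ℝ) * (n : ℝ) - 6 = ((11 * (n : ℤ) - 24 : ℤ) : ℝ) / ((4 : ℕ) : ℝ) := by
    push_cast
    ring
  rw [h, Int.floor_div_natCast, Int.floor_intCast]
  rfl

theorem corollary3 (n : ℕ) (hn : 4 ≤ n) :
    IsGreatest (planeEdgeCounts 4 n) ⌊(11 / 4 : ℝ) * (n : ℝ) - 6⌋ := by
  rw [floor_edge_bound]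
  refine ⟨⟨blockDrawing.graph n, blockDrawing.drawing n, everyVertexBounds_blockDrawing hn,
    ncard_edgeSet_blockDrawing hn⟩, ?_⟩
  rintro _ ⟨G, D, hD, rfl⟩
  have : Nonempty (Fin n) := ⟨⟨0, by omega⟩⟩
  have h := D.four_mul_ncard_edgeSet_le hD
  rw [Nat.card_eq_fintype_card, Fintype.card_fin] at h
  omega
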